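/- For integers $k\ge 1$ and $n\ge 1$ let $H_n^{(k)}=\sum_{j=1}^n j^{-k}$. For an integer $p>1$ and a finite (possibly empty) multiset $\{a(1),\dots,a(M)\}$ of positive integers define the inverse binomial Euler sum $$IBES(a(1),\dots,a(M);p)=\sum_{n=1}^\infty \frac{4^n}{n^p\binom{2n}{n}}\prod_{k=1}^M H_n^{(a(k))},$$ and its weight $W=p+\sum_{k=1}^M a(k)$ (an empty product is $1$). Put $\mathrm{Li}_s(\tfrac12)=\sum_{n\ge1}2^{-n}n^{-s}$ and $$A_1=\{\log 2\},\quad A_2=\{\pi^2,\log^2 2\},\quad A_3=\{\pi^2\log 2,\log^3 2,\zeta(3)\},$$ $$A_4=\{\pi^4,\pi^2\log^2 2,\log^4 2,\zeta(3)\log 2,\mathrm{Li}_4(\tfrac12)\},$$ $$A_5=\{\pi^4\log 2,\pi^2\log^3 2,\log^5 2,\pi^2\zeta(3),\zeta(3)\log^2 2,\zeta(5),\mathrm{Li}_4(\tfrac12)\log 2,\mathrm{Li}_5(\tfrac12)\}.$$ Then there are exactly 14 inverse binomial Euler sums (that is, choices of the multiset $\{a(k)\}$ and of $p$) of weight $W\le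 5$; each of these series converges, and its value lies in the $\mathbb{Q}$-linear span of $A_W$, where $W$ is its own weight. -/

import Mathlib

/-- The generalized harmonic number `H_n^{(k)} = ∑_{j=1}^n 1 / j^k`. -/
noncomputable def genHarmonic (k n : ℕ) : ℝ :=
  ∑ j ∈ Finset.Icc 1 n, 1 / (j : ℝ) ^ k

/-- The summand `4^n / (n^p * binom(2n, n)) * ∏_k H_n^{(a(k))}` of an inverse binomial Euler sum.
The indices `a(1), …, a(M)` form a multiset, which may be empty. -/
noncomputable def ibesTerm (a : Multiset ℕ) (p n : ℕ) : ℝ :=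
  4 ^ n / ((n : ℝ) ^ p * ((2 * n).choose n : ℝ)) * (a.map fun k => genHarmonic k n).prod

/-- The inverse binomial Euler sum `∑_{n ≥ 1} 4^n / (n^p * binom(2n, n)) * ∏_k H_n^{(a(k))}`. -/
noncomputable def IBES (a : Multiset ℕ) (p : ℕ) : ℝ :=
  ∑' n : ℕ, ibesTerm a p (n + 1)

/-- The weight `∑_k a(k) + p`. -/
def ibesWeight (a : Multiset ℕ) (p : ℕ) : ℕ :=
  a.sum + p

/-- The index pairs `(a, p)` of the inverse binomial Euler sums of weight at most `W`: every
`a(k)` is at least `1`, and `p > 1`. -/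
def ibesIndices (W : ℕ) : Set (Multiset ℕ × ℕ) :=
  {ap | (∀ k ∈ ap.1, 1 ≤ k) ∧ 1 < ap.2 ∧ ibesWeight ap.1 ap.2 ≤ W}

/-- The polylogarithm value `Li_s(1/2) = ∑_{n ≥ 1} (1/2)^n / n^s`. -/
noncomputable def polylogHalf (s : ℕ) : ℝ :=
  ∑' n : ℕ, (1 / 2 : ℝ) ^ (n + 1) / ((n : ℝ) + 1) ^ s

/-- The value `ζ(s)` as a real number; it is real for integers `s ≥ 2`. -/
noncomputable def zetaVal (s : ℕ) : ℝ :=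
  (riemannZeta (s : ℂ)).re

/-- The weight `W` Fibonacci basis `A_W`, for `1 ≤ W ≤ 5`; other values of `W` are not used. -/
noncomputable def fibBasis : ℕ → Set ℝ
  | 1 => {Real.log 2}
  | 2 => {Real.pi ^ 2, Real.log 2 ^ 2}
  | 3 => {Real.pi ^ 2 * Real.log 2, Real.log 2 ^ 3, zetaVal 3}
  | 4 => {Real.pi ^ 4, Real.pi ^ 2 * Real.log 2 ^ 2, Real.log 2 ^ 4, zetaVal 3 * Real.log 2,
      polylogHalf 4}
  | 5 => {Real.pi ^ 4 * Real.log 2, Real.pi ^ 2 * Real.log 2 ^ 3, Real.log 2 ^ 5,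
      Real.pi ^ 2 * zetaVal 3, zetaVal 3 * Real.log 2 ^ 2, zetaVal 5,
      polylogHalf 4 * Real.log 2, polylogHalf 5}
  | _ => ∅

/-! The weight `4^n / (n * binom(2n, n))` is the integral over `(0, 1)` of `X^n dv / v`, where `X =
4v / (1 + v)^2`. A product of harmonic numbers expands into nested sums, and nested sums are the
Taylor coefficients of iterated integrals in `dt/t` and `dt/(1 - t)`. An inverse binomial Euler sum
is therefore a combination of integrals of `L(X(v)) dv / v` with `L` such an iterated integral. The
pullbacks of `dt/t` and `dt/(1 - t)` along `X` are integral combinations of `dv/v`, `dv/(1 - v)` and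
`dv/(1 + v)`, so the sum becomes an integral combination of alternating Euler sums of the same
weight (`hasValue_binomWeight`, `hasValue_ofIBES`).

Alternating Euler sums satisfy many linear relations. A product of two of them expands by shuffles
(Leibniz rule, `polylog_mul_polylog`) and by quasi-shuffles (products of partial sums,
`partialSum_mul_partialSum`), and the difference of the two expansions tends to 0 at 1
(`hasValue_stuffleRel`). The map `t ↦ t^2` gives distribution relations (`hasValue_squareRel`), and
a relation may be multiplied by a convergent word. The basis constants are combinations of words
too: zeta values and `log 2` directly, `Li_s(1/2)` through `t ↦ t / (1 + t)`.

For each of the sums an explicit identity in the free module on words expresses an integer multiple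
of it through basis constants and relations. The kernel checks the identity by computation
(`mem_span_of_certifies`).

A value is always the limit at 1 of a whole combination, viewed as a function on `(0, 1)`. Single
words may diverge there; they cancel formally before the limit is taken, so no regularization is
needed. -/

open Filter Topology

/-! ### Iterated integrals as power series: coefficient bounds and derivatives. -/

/-- The differential forms `dt / t`, `dt / (1 - t)` and `dt / (1 + t)`. -/
inductive Letter
  | o
  | p
  | m

/-- A word of differential forms; the head is the outermost form of the iterated integral. -/
abbrev Word := List Letter

namespace Word

/-- The Taylor coefficients at `0` of the iterated integral of a word. -/
noncomputable def coef : Word → ℕ → ℝ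
  | [], n => if n = 0 then 1 else 0
  | .o :: w, n => coef w n / n
  | .p :: w, n => (∑ k ∈ Finset.range n, coef w k) / n
  | .m :: w, n => (∑ k ∈ Finset.range n, coef w k * (-1) ^ (n - 1 - k)) / n

/-- The iterated integral of a word from `0` to `v`, as a power series. -/
noncomputable def polylog (w : Word) (v : ℝ) : ℝ :=
  ∑' n : ℕ, coef w n * v ^ n

/-- The density of a letter. -/
noncomputable def form : Letter → ℝ → ℝ
  | .o, v => 1 / v
  | .p, v => 1 / (1 - v)
  | .m, v => 1 / (1 + v)

theorem coef_cons_zero (x : Letter) (w : Word) : coef (x :: w) 0 = 0 := by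
  cases x <;> simp [coef]

theorem sum_rpow_le (n : ℕ) :
    ∑ k ∈ Finset.range (n + 1), (k : ℝ) ^ (-(3 / 4) : ℝ) ≤ 4 * (n : ℝ) ^ (1 / 4 : ℝ) := by
  induction n with
  | zero => simp
  | succ n ih =>
    rw [Finset.sum_range_succ]
    have hx : (0 : ℝ) ≤ n := by positivity
    have hy : (0 : ℝ) < (n : ℝ) + 1 := by positivity
    set x := (n : ℝ) ^ (1 / 4 : ℝ) with hxd
    set y := ((n : ℝ) + 1) ^ (1 / 4 : ℝ) with hyd
    have hx4 : x ^ 4 = n := by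
      rw [hxd, ← Real.rpow_natCast, ← Real.rpow_mul hx]; norm_num
    have hy4 : y ^ 4 = n + 1 := by
      rw [hyd, ← Real.rpow_natCast, ← Real.rpow_mul hy.le]; norm_num
    have hx0 : 0 ≤ x := by positivity
    have hy0 : 0 < y := by positivity
    have hxy : x ≤ y := by
      rw [hxd, hyd]; exact Real.rpow_le_rpow hx (by linarith) (by norm_num)
    have h3 : ((n : ℝ) + 1) ^ (-(3 / 4) : ℝ) = 1 / y ^ 3 := by
      rw [hyd, ← Real.rpow_natCast, ← Real.rpow_mul hy.le, Real.rpow_neg hy.le]; norm_num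
    -- Here `x`, `y` are the fourth roots of `n`, `n + 1`, and `y^4 - x^4 = 1` factors as `y - x`
    -- times four terms, each at most `y^3`.
    have key : 1 / y ^ 3 ≤ 4 * (y - x) := by
      rw [div_le_iff₀ (by positivity)]
      have h1 : x ^ 3 ≤ y ^ 3 := by gcongr
      have h2 : x ^ 2 * y ≤ y ^ 3 := by
        calc x ^ 2 * y ≤ y ^ 2 * y := by gcongr
          _ = y ^ 3 := by ring
      have h4 : x * y ^ 2 ≤ y ^ 3 := by
        calc x * y ^ 2 ≤ y * y ^ 2 := by gcongr
          _ = y ^ 3 := by ring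
      have h5 : (y - x) * (y ^ 3 + x * y ^ 2 + x ^ 2 * y + x ^ 3) = 1 := by
        linear_combination hy4 - hx4
      have h6 : 0 ≤ (y - x) * (4 * y ^ 3 - (y ^ 3 + x * y ^ 2 + x ^ 2 * y + x ^ 3)) :=
        mul_nonneg (by linarith) (by linarith)
      linarith
    push_cast
    rw [h3]
    linarith

theorem sum_rpow_le' (n : ℕ) :
    ∑ k ∈ Finset.range n, (k : ℝ) ^ (-(3 / 4) : ℝ) ≤ 4 * (n : ℝ) ^ (1 / 4 : ℝ) :=
  (Finset.sum_le_sum_of_subset_of_nonneg (Finset.range_mono n.le_succ)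
    fun _ _ _ => by positivity).trans (sum_rpow_le n)

/-- The hypothesis says nothing at index 0. That coefficient vanishes except for the empty word,
whose single 1 is absorbed by `1 ≤ K`. -/
theorem sum_abs_le_of_coef_le {w : Word} {K : ℝ} (hK : 1 ≤ K)
    (h : ∀ n : ℕ, 1 ≤ n → |coef w n| ≤ K * (n : ℝ) ^ (-(3 / 4) : ℝ)) (n : ℕ) :
    ∑ k ∈ Finset.range n, |coef w k| ≤ 4 * K * (n : ℝ) ^ (1 / 4 : ℝ) := by
  rcases w with _ | ⟨x, w⟩
  · rcases Nat.eq_zero_or_pos n with rfl | hn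
    · simp
    · have : ∑ k ∈ Finset.range n, |coef [] k| = 1 := by
        rw [Finset.sum_eq_single 0]
        · simp [coef]
        · intro b _ hb; simp [coef, hb]
        · intro h0; simp at h0; omega
      rw [this]
      have h1 : (1 : ℝ) ≤ (n : ℝ) ^ (1 / 4 : ℝ) :=
        Real.one_le_rpow (by exact_mod_cast hn) (by norm_num)
      nlinarith
  · calc ∑ k ∈ Finset.range n, |coef (x :: w) k|
        ≤ ∑ k ∈ Finset.range n, K * (k : ℝ) ^ (-(3 / 4) : ℝ) := by
          refine Finset.sum_le_sum fun k _ => ?_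
          rcases Nat.eq_zero_or_pos k with rfl | hk
          · rw [coef_cons_zero]; simp
          · exact h k hk
      _ = K * ∑ k ∈ Finset.range n, (k : ℝ) ^ (-(3 / 4) : ℝ) := by rw [Finset.mul_sum]
      _ ≤ K * (4 * (n : ℝ) ^ (1 / 4 : ℝ)) := by gcongr; exact sum_rpow_le' n
      _ = _ := by ring

/-- The coefficients are really at most a power of `log n` over `n`. The exponent `-3/4` absorbs the
logarithms and survives the induction: summation gives `n^(1/4)`, and each letter divides by `n`. It
also leaves room for the factor `n^(-1/2)` of the binomial weight. -/
theorem abs_coef_le (w : Word) :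
    ∀ n : ℕ, 1 ≤ n → |coef w n| ≤ 4 ^ w.length * (n : ℝ) ^ (-(3 / 4) : ℝ) := by
  induction w with
  | nil => intro n hn; simp [coef, Nat.one_le_iff_ne_zero.mp hn]; positivity
  | cons x w ih =>
    intro n hn
    have hn' : (1 : ℝ) ≤ n := by exact_mod_cast hn
    have hS := sum_abs_le_of_coef_le (one_le_pow₀ (by norm_num)) ih n
    have hdiv : (n : ℝ) ^ (1 / 4 : ℝ) / n = (n : ℝ) ^ (-(3 / 4) : ℝ) := by
      rw [← Real.rpow_sub_one (by positivity)]; norm_num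
    have hfin : ∀ s : ℝ, |s| ≤ 4 * 4 ^ w.length * (n : ℝ) ^ (1 / 4 : ℝ) →
        |s / n| ≤ 4 ^ (x :: w).length * (n : ℝ) ^ (-(3 / 4) : ℝ) := by
      intro s hs
      rw [abs_div, abs_of_pos (show (0 : ℝ) < n by linarith), ← hdiv, List.length_cons, pow_succ',
        ← mul_div_assoc]
      gcongr
    cases x with
    | o =>
      refine hfin _ ((ih n hn).trans ?_)
      have h1 : (n : ℝ) ^ (-(3 / 4) : ℝ) ≤ (n : ℝ) ^ (1 / 4 : ℝ) :=
        Real.rpow_le_rpow_of_exponent_le hn' (by norm_num)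
      have h2 : (0 : ℝ) ≤ 4 ^ w.length * (n : ℝ) ^ (1 / 4 : ℝ) := by positivity
      have h3 := mul_le_mul_of_nonneg_left h1 (show (0 : ℝ) ≤ 4 ^ w.length by positivity)
      linarith
    | p => exact hfin _ ((Finset.abs_sum_le_sum_abs _ _).trans hS)
    | m =>
      refine hfin _ ((Finset.abs_sum_le_sum_abs _ _).trans (le_of_eq_of_le ?_ hS))
      refine Finset.sum_congr rfl fun k _ => ?_
      simp [abs_mul]

theorem abs_coef_le_const (w : Word) (n : ℕ) : |coef w n| ≤ 4 ^ w.length := by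
  rcases Nat.eq_zero_or_pos n with rfl | hn
  · rcases w with _ | ⟨x, w⟩
    · simp [coef]
    · rw [coef_cons_zero]; simp
  · refine (abs_coef_le w n hn).trans (mul_le_of_le_one_right (by positivity) ?_)
    exact Real.rpow_le_one_of_one_le_of_nonpos (by exact_mod_cast hn) (by norm_num)

theorem summable_norm_mul_pow {c : ℕ → ℝ} {K : ℝ} (hc : ∀ n, |c n| ≤ K) {v : ℝ} (hv : |v| < 1) :
    Summable fun n => ‖c n * v ^ n‖ := by
  refine Summable.of_nonneg_of_le (fun _ => norm_nonneg _) (fun n => ?_)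
    ((summable_geometric_of_lt_one (abs_nonneg v) hv).mul_left K)
  rw [norm_mul, norm_pow, Real.norm_eq_abs, Real.norm_eq_abs]
  exact mul_le_mul_of_nonneg_right (hc n) (by positivity)

theorem hasDerivAt_tsum_mul_pow {c : ℕ → ℝ} {K : ℝ} (hc : ∀ n, |c n| ≤ K) {v : ℝ}
    (hv : |v| < 1) :
    HasDerivAt (fun v => ∑' n, c n * v ^ n) (∑' n, c n * (n * v ^ (n - 1))) v := by
  obtain ⟨r, hr, hr1⟩ := exists_between hv
  have hr0 : 0 < r := (abs_nonneg v).trans_lt hr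
  have hK : 0 ≤ K := (abs_nonneg _).trans (hc 0)
  have hu : Summable fun n : ℕ => K * (n * r ^ (n - 1)) := by
    refine Summable.mul_left K ?_
    have h := summable_pow_mul_geometric_of_norm_lt_one 1
      (show ‖r‖ < 1 by rwa [Real.norm_eq_abs, abs_of_pos hr0])
    refine (h.mul_left r⁻¹).congr fun n => ?_
    rcases n with _ | n
    · simp
    · simp only [Nat.add_sub_cancel, pow_succ]; field_simp
  refine hasDerivAt_tsum_of_isPreconnected hu Metric.isOpen_ball
    (convex_ball (0 : ℝ) r).isPreconnected (g := fun n v => c n * v ^ n)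
    (g' := fun n v => c n * (n * v ^ (n - 1))) (y₀ := 0) ?_ ?_ ?_ ?_ ?_
  · intro n y _
    exact (hasDerivAt_pow n y).const_mul (c n)
  · intro n y hy
    have hy' : |y| ≤ r := by simpa using (mem_ball_zero_iff.mp hy).le
    rw [norm_mul, norm_mul, norm_pow, Real.norm_eq_abs, Real.norm_eq_abs, Real.norm_eq_abs,
      Nat.abs_cast]
    gcongr
    exact hc n
  · exact Metric.mem_ball_self hr0
  · exact (summable_norm_mul_pow hc (by simp)).of_norm
  · simpa using hr

/-- Cauchy product with the geometric series in `e * v`; `e = 1` serves the letter `p` and `e = -1`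
the letter `m`. -/
theorem tsum_sum_range_mul_pow {c : ℕ → ℝ} {K : ℝ} (hc : ∀ n, |c n| ≤ K) {v e : ℝ}
    (hv : |v| < 1) (he : |e| = 1) :
    ∑' n, (∑ k ∈ Finset.range n, c k * e ^ (n - 1 - k)) * v ^ (n - 1) =
      1 / (1 - e * v) * ∑' n, c n * v ^ n := by
  have hev : |e * v| < 1 := by rwa [abs_mul, he, one_mul]
  have h2 : Summable fun n => ‖(e * v) ^ n‖ := by
    simpa using summable_norm_mul_pow (c := fun _ => 1) (K := 1) (by simp) hev
  have hprod := tsum_mul_tsum_eq_tsum_sum_range_of_summable_norm (summable_norm_mul_pow hc hv) h2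
  have hterm : ∀ n, ∑ k ∈ Finset.range (n + 1), c k * v ^ k * (e * v) ^ (n - k) =
      (∑ k ∈ Finset.range (n + 1), c k * e ^ (n - k)) * v ^ n := by
    intro n
    rw [Finset.sum_mul]
    refine Finset.sum_congr rfl fun k hk => ?_
    have : v ^ n = v ^ k * v ^ (n - k) := by
      rw [← pow_add]; congr 1; have := Finset.mem_range.mp hk; omega
    rw [this, mul_pow]; ring
  have hsum := summable_norm_sum_mul_range_of_summable_norm (summable_norm_mul_pow hc hv) h2
  simp_rw [hterm] at hprod hsum
  have hs : Summable fun n => (∑ k ∈ Finset.range n, c k * e ^ (n - 1 - k)) * v ^ (n - 1) := by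
    rw [← summable_nat_add_iff 1]
    exact hsum.of_norm
  rw [hs.tsum_eq_zero_add]
  simp only [Finset.range_zero, Finset.sum_empty, zero_mul, zero_add, Nat.add_sub_cancel]
  rw [← hprod, tsum_geometric_of_abs_lt_one hev]
  ring

/-- The word `[.o]` must be excluded: `dt/t` is not integrable at 0, and division by zero makes its
power series vanish identically. -/
theorem hasDerivAt_polylog {x : Letter} {w : Word} (hw : x = .o → w ≠ []) {v : ℝ}
    (hv : v ∈ Set.Ioo (0 : ℝ) 1) :
    HasDerivAt (polylog (x :: w)) (form x v * polylog w v) v := by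
  have hv1 : |v| < 1 := by rw [abs_of_pos hv.1]; exact hv.2
  have h := hasDerivAt_tsum_mul_pow (abs_coef_le_const (x :: w)) hv1
  refine h.congr_deriv ?_
  cases x with
  | o =>
    rw [polylog, ← tsum_mul_left]
    refine tsum_congr fun n => ?_
    rcases n with _ | n
    · rcases w with _ | ⟨y, w⟩
      · exact absurd rfl (hw rfl)
      · simp [coef_cons_zero]
    · have := hv.1.ne'
      simp only [coef, form, Nat.add_sub_cancel, pow_succ]
      push_cast
      field_simp
  | p =>
    have := tsum_sum_range_mul_pow (abs_coef_le_const w) hv1 (e := 1) (by simp)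
    simp only [one_pow, mul_one, one_mul] at this
    rw [form, polylog, ← this]
    refine tsum_congr fun n => ?_
    rcases n with _ | n
    · simp
    · simp only [coef]
      have : ((n + 1 : ℕ) : ℝ) ≠ 0 := by positivity
      field_simp
  | m =>
    have := tsum_sum_range_mul_pow (abs_coef_le_const w) hv1 (e := -1) (by simp)
    simp only [neg_mul, one_mul, sub_neg_eq_add] at this
    rw [form, polylog, ← this]
    refine tsum_congr fun n => ?_
    rcases n with _ | n
    · simp
    · simp only [coef]
      have : ((n + 1 : ℕ) : ℝ) ≠ 0 := by positivity
      field_simp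

theorem polylog_nil (v : ℝ) : polylog [] v = 1 := by
  rw [polylog, tsum_eq_single 0]
  · simp [coef]
  · intro n hn; simp [coef, hn]

theorem tendsto_polylog_zero (x : Letter) (w : Word) :
    Tendsto (polylog (x :: w)) (𝓝[>] 0) (𝓝 0) := by
  have h := (hasDerivAt_tsum_mul_pow (abs_coef_le_const (x :: w)) (v := 0)
    (by simp)).continuousAt.tendsto
  have h0 : ∑' n, coef (x :: w) n * (0 : ℝ) ^ n = 0 := by
    rw [tsum_eq_single 0]
    · simp [coef_cons_zero]
    · intro n hn; simp [hn]
  rw [h0] at h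
  exact h.mono_left nhdsWithin_le_nhds

/-- Two functions on `(0, 1)` with the same derivative and the same limit at `0` agree. -/
theorem eqOn_of_hasDerivAt {f g f' : ℝ → ℝ} {l : ℝ}
    (hf : ∀ v ∈ Set.Ioo (0 : ℝ) 1, HasDerivAt f (f' v) v)
    (hg : ∀ v ∈ Set.Ioo (0 : ℝ) 1, HasDerivAt g (f' v) v)
    (hf0 : Tendsto f (𝓝[>] 0) (𝓝 l)) (hg0 : Tendsto g (𝓝[>] 0) (𝓝 l)) :
    Set.EqOn f g (Set.Ioo 0 1) := by
  have hd : ∀ v ∈ Set.Ioo (0 : ℝ) 1, HasDerivAt (fun v => f v - g v) 0 v := fun v hv =>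
    ((hf v hv).fun_sub (hg v hv)).congr_deriv (sub_self _)
  have hconst : ∀ x ∈ Set.Ioo (0 : ℝ) 1, ∀ y ∈ Set.Ioo (0 : ℝ) 1, f x - g x = f y - g y := by
    intro x hx y hy
    refine (isOpen_Ioo).is_const_of_deriv_eq_zero (isPreconnected_Ioo)
      (f := fun v => f v - g v) ?_ ?_ hx hy
    · exact fun v hv => (hd v hv).differentiableAt.differentiableWithinAt
    · exact fun v hv => (hd v hv).deriv
  intro x hx
  have hlim : Tendsto (fun v => f v - g v) (𝓝[>] 0) (𝓝 (l - l)) := hf0.sub hg0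
  have hev : (fun v => f v - g v) =ᶠ[𝓝[>] 0] fun _ => f x - g x := by
    filter_upwards [Ioo_mem_nhdsGT (show (0 : ℝ) < 1 by norm_num)] with v hv
    exact hconst v hv x hx
  have := tendsto_nhds_unique (hlim.congr' hev) tendsto_const_nhds
  linarith

end Word

/-! ### Shuffle products and pullbacks of iterated integrals. -/

/-- Formal integral combinations of words. -/
abbrev WordComb := List (ℤ × Word)

namespace Word

/-- The innermost letter of the word is not `o`. -/
def proper : Word → Bool
  | [] => true
  | .o :: w => !w.isEmpty && proper w
  | .p :: w => proper w
  | .m :: w => proper w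

theorem proper_cons {x : Letter} {w : Word} :
    proper (x :: w) = true ↔ (x = .o → w ≠ []) ∧ proper w = true := by
  cases x <;> simp [proper]

/-- Auxiliary recursion for `shuffle`, along the second word. -/
def shuffleAux (x : Letter) (u : Word) (f : Word → List Word) : Word → List Word
  | [] => [x :: u]
  | y :: w => (f (y :: w)).map (x :: ·) ++ (shuffleAux x u f w).map (y :: ·)

/-- The list of all shuffles of two words. -/
def shuffle : Word → Word → List Word
  | [] => fun w => [w]
  | x :: u => shuffleAux x u (shuffle u)

theorem shuffle_nil_right (u : Word) : shuffle u [] = [u] := by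
  cases u <;> rfl

theorem shuffle_cons_cons (x y : Letter) (u w : Word) :
    shuffle (x :: u) (y :: w) =
      (shuffle u (y :: w)).map (x :: ·) ++ (shuffle (x :: u) w).map (y :: ·) := rfl

/-- The sum of a function of words over a list. -/
def sumOver (f : Word → ℝ) (l : List Word) : ℝ := (l.map f).sum

theorem sumOver_append (f : Word → ℝ) (l l' : List Word) :
    sumOver f (l ++ l') = sumOver f l + sumOver f l' := by
  simp [sumOver]

theorem ne_nil_of_mem_shuffle {u w t : Word} (ht : t ∈ shuffle u w) (h : u ≠ [] ∨ w ≠ []) :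
    t ≠ [] := by
  rintro rfl
  rcases u with _ | ⟨x, u⟩
  · simp [shuffle] at ht; simp [← ht] at h
  rcases w with _ | ⟨y, w⟩
  · simp [shuffle, shuffleAux] at ht
  · simp [shuffle_cons_cons] at ht

theorem hasDerivAt_sumOver {l : List Word} {x : Letter} (hl : ∀ w ∈ l, x = .o → w ≠ []) {v : ℝ}
    (hv : v ∈ Set.Ioo (0 : ℝ) 1) :
    HasDerivAt (fun v => sumOver (fun w => polylog w v) (l.map (x :: ·)))
      (form x v * sumOver (fun w => polylog w v) l) v := by
  induction l with
  | nil => simpa [sumOver] using hasDerivAt_const v (0 : ℝ)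
  | cons w l ih =>
    have h1 := hasDerivAt_polylog (hl w (by simp)) hv
    have h2 := ih fun w hw => hl w (by simp [hw])
    have := h1.fun_add h2
    simp only [sumOver, List.map_cons, List.sum_cons] at this ⊢
    exact this.congr_deriv (by ring)

theorem tendsto_sumOver_zero (l : List Word) (hl : ∀ w ∈ l, w ≠ []) :
    Tendsto (fun v => sumOver (fun w => polylog w v) l) (𝓝[>] 0) (𝓝 0) := by
  induction l with
  | nil => simp [sumOver]
  | cons w l ih =>
    have h2 := ih fun w hw => hl w (by simp [hw])
    rcases w with _ | ⟨x, w⟩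
    · exact absurd rfl (hl [] (by simp))
    · simpa [sumOver] using (tendsto_polylog_zero x w).add h2

/-- Leibniz rule: differentiating removes the head of one factor or of the other, exactly as in the
shuffle recursion, and both sides tend to 0 at 0. The induction runs over both words. -/
theorem polylog_mul_polylog {u w : Word} (hu : proper u) (hw : proper w) {v : ℝ}
    (hv : v ∈ Set.Ioo (0 : ℝ) 1) :
    polylog u v * polylog w v = sumOver (fun t => polylog t v) (shuffle u w) := by
  induction u generalizing w v with
  | nil => simp [shuffle, sumOver, polylog_nil]
  | cons x u ihu =>
    induction w generalizing v with
    | nil => simp [shuffle_nil_right, sumOver, polylog_nil]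
    | cons y w ihw =>
      rw [proper_cons] at hu hw
      refine eqOn_of_hasDerivAt (f := fun v => polylog (x :: u) v * polylog (y :: w) v)
        (g := fun v => sumOver (fun t => polylog t v) (shuffle (x :: u) (y :: w))) (l := 0)
        (f' := fun v => form x v * polylog u v * polylog (y :: w) v +
          polylog (x :: u) v * (form y v * polylog w v)) ?_ ?_ ?_ ?_ hv
      · intro v hv
        exact (hasDerivAt_polylog hu.1 hv).fun_mul (hasDerivAt_polylog hw.1 hv)
      · intro v hv
        have h1 := hasDerivAt_sumOver (l := shuffle u (y :: w)) (x := x)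
          (fun t ht _ => ne_nil_of_mem_shuffle ht (by simp)) hv
        have h2 := hasDerivAt_sumOver (l := shuffle (x :: u) w) (x := y)
          (fun t ht _ => ne_nil_of_mem_shuffle ht (by simp)) hv
        simp only [shuffle_cons_cons, sumOver_append]
        refine (h1.fun_add h2).congr_deriv ?_
        rw [← ihu hu.2 (proper_cons.mpr hw) hv, ← ihw hw.2 hv]
        ring
      · simpa using (tendsto_polylog_zero x u).mul (tendsto_polylog_zero y w)
      · exact tendsto_sumOver_zero _ fun t ht => ne_nil_of_mem_shuffle ht (by simp)

end Word

namespace WordComb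

open Word

/-- Linear extension of a function of words. -/
def eval (f : Word → ℝ) (r : WordComb) : ℝ := (r.map fun t => (t.1 : ℝ) * f t.2).sum

theorem eval_cons (f : Word → ℝ) (t : ℤ × Word) (r : WordComb) :
    eval f (t :: r) = t.1 * f t.2 + eval f r := by simp [eval]

theorem eval_append (f : Word → ℝ) (r s : WordComb) : eval f (r ++ s) = eval f r + eval f s := by
  simp [eval]

/-- Multiplication by an integer. -/
def smul (c : ℤ) (r : WordComb) : WordComb := r.map fun t => (c * t.1, t.2)

theorem eval_smul (f : Word → ℝ) (c : ℤ) (r : WordComb) : eval f (smul c r) = c * eval f r := by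
  induction r with
  | nil => simp [smul, eval]
  | cons t r ih =>
    simp only [smul, List.map_cons, eval_cons] at ih ⊢
    rw [ih]; push_cast; ring

/-- Apply a map to the words of a combination. -/
def mapWord (g : Word → Word) (r : WordComb) : WordComb := r.map fun t => (t.1, g t.2)

/-- A list of words with coefficient `c`. -/
def ofList (c : ℤ) (l : List Word) : WordComb := l.map fun w => (c, w)

theorem eval_ofList (f : Word → ℝ) (c : ℤ) (l : List Word) :
    eval f (ofList c l) = c * sumOver f l := by
  induction l with
  | nil => simp [ofList, eval, sumOver]
  | cons w l ih =>
    simp only [ofList, List.map_cons, eval_cons, sumOver, List.sum_cons] at ih ⊢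
    rw [ih]; ring

/-- The shuffle product of combinations. -/
def mul (r s : WordComb) : WordComb :=
  r.flatMap fun t => s.flatMap fun t' => ofList (t.1 * t'.1) (shuffle t.2 t'.2)

/-- All words are proper. -/
def isProper (r : WordComb) : Bool := r.all fun t => proper t.2

/-- The value at `v` of a combination of iterated integrals. -/
noncomputable def value (r : WordComb) (v : ℝ) : ℝ := eval (fun w => polylog w v) r

theorem value_nil : value [] = fun _ => 0 := rfl

theorem value_cons (t : ℤ × Word) (r : WordComb) :
    value (t :: r) = fun v => t.1 * polylog t.2 v + value r v := by
  funext v; exact eval_cons _ t r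

theorem value_append (r s : WordComb) : value (r ++ s) = fun v => value r v + value s v := by
  funext v; exact eval_append _ r s

theorem value_smul (c : ℤ) (r : WordComb) : value (smul c r) = fun v => c * value r v := by
  funext v; exact eval_smul _ c r

theorem value_mul {r s : WordComb} (hr : isProper r) (hs : isProper s) {v : ℝ}
    (hv : v ∈ Set.Ioo (0 : ℝ) 1) : value (mul r s) v = value r v * value s v := by
  induction r with
  | nil => simp [mul, value, eval]
  | cons t r ih =>
    simp only [isProper, List.all_cons, Bool.and_eq_true] at hr ih
    have h1 : value (s.flatMap fun t' => ofList (t.1 * t'.1) (shuffle t.2 t'.2)) v =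
        t.1 * polylog t.2 v * value s v := by
      clear ih
      induction s with
      | nil => simp [value, eval]
      | cons t' s ih =>
        simp only [isProper, List.all_cons, Bool.and_eq_true] at hs ih
        simp only [value, List.flatMap_cons, eval_append, eval_cons, eval_ofList] at ih ⊢
        rw [ih hs.2, ← polylog_mul_polylog hr.1 hs.1 hv]
        push_cast; ring
    have h2 := ih hr.2
    simp only [value, mul, List.flatMap_cons, eval_append, eval_cons] at h1 h2 ⊢
    rw [h1, h2]; ring

/-- Substitution of combinations of letters for letters in a word. -/
def subst (φ : Letter → List (ℤ × Letter)) : Word → WordComb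
  | [] => [(1, [])]
  | x :: w => (φ x).flatMap fun t => smul t.1 (mapWord (t.2 :: ·) (subst φ w))

theorem hasDerivAt_value_mapWord {r : WordComb} {x : Letter} (hr : ∀ t ∈ r, x = .o → t.2 ≠ [])
    {v : ℝ} (hv : v ∈ Set.Ioo (0 : ℝ) 1) :
    HasDerivAt (value (mapWord (x :: ·) r)) (form x v * value r v) v := by
  induction r with
  | nil => exact (hasDerivAt_const v (0 : ℝ)).congr_deriv (by simp [value_nil])
  | cons t r ih =>
    have h1 := (hasDerivAt_polylog (hr t (by simp)) hv).const_mul (t.1 : ℝ)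
    have h2 := ih fun t ht => hr t (by simp [ht])
    rw [mapWord, List.map_cons, value_cons]
    refine (h1.fun_add h2).congr_deriv ?_
    simp only [value_cons]; ring

theorem tendsto_value_zero {r : WordComb} (hr : ∀ t ∈ r, t.2 ≠ []) :
    Tendsto (value r) (𝓝[>] 0) (𝓝 0) := by
  induction r with
  | nil => exact tendsto_const_nhds
  | cons t r ih =>
    have h2 := ih fun w hw => hr w (by simp [hw])
    obtain ⟨c, _ | ⟨x, w⟩⟩ := t
    · exact absurd rfl (hr (c, []) (by simp))
    · rw [value_cons]
      simpa using ((tendsto_polylog_zero x w).const_mul (c : ℝ)).add h2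

theorem ne_nil_of_mem_subst {φ : Letter → List (ℤ × Letter)} {w : Word} (hw : w ≠ [])
    {t : ℤ × Word} (ht : t ∈ subst φ w) : t.2 ≠ [] := by
  rcases w with _ | ⟨x, w⟩
  · exact absurd rfl hw
  · simp only [subst, smul, mapWord, List.mem_flatMap, List.mem_map] at ht
    obtain ⟨s, -, q, ⟨q', -, rfl⟩, rfl⟩ := ht
    simp

/-- The pullback of iterated integrals in `o` and `p` along a map of `(0, 1)`. -/
theorem value_subst {φ : Letter → List (ℤ × Letter)} {g g' : ℝ → ℝ}
    (hg : ∀ v ∈ Set.Ioo (0 : ℝ) 1, HasDerivAt g (g' v) v)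
    (hmaps : ∀ v ∈ Set.Ioo (0 : ℝ) 1, g v ∈ Set.Ioo (0 : ℝ) 1)
    (hg0 : Tendsto g (𝓝[>] 0) (𝓝 0))
    (hp : ∀ t ∈ φ .p, t.2 ≠ .o)
    (hform : ∀ x, x ≠ .m → ∀ v ∈ Set.Ioo (0 : ℝ) 1,
      form x (g v) * g' v = ((φ x).map fun t => (t.1 : ℝ) * form t.2 v).sum)
    {w : Word} (hw : proper w) (hm : ∀ x ∈ w, x ≠ .m) {v : ℝ} (hv : v ∈ Set.Ioo (0 : ℝ) 1) :
    value (subst φ w) v = polylog w (g v) := by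
  induction w generalizing v with
  | nil => simp [subst, value, eval, polylog_nil]
  | cons x w ih =>
    rw [proper_cons] at hw
    have ih' := fun v hv => ih hw.2 (fun y hy => hm y (by simp [hy])) (v := v) hv
    have hxm : x ≠ .m := hm x (by simp)
    -- No word ending in `o` arises: only `o` can produce `o`, and properness keeps `o` away from
    -- the innermost place.
    have hx : ∀ s ∈ φ x, ∀ t ∈ subst φ w, s.2 = .o → t.2 ≠ [] := by
      intro s hs t ht hso
      cases x with
      | o => exact ne_nil_of_mem_subst (hw.1 rfl) ht
      | p => exact absurd hso (hp s hs)
      | m => exact absurd rfl hxm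
    have hderiv : ∀ (l : List (ℤ × Letter)),
        (∀ s ∈ l, ∀ t ∈ subst φ w, s.2 = .o → t.2 ≠ []) → ∀ v ∈ Set.Ioo (0 : ℝ) 1,
        HasDerivAt (value (l.flatMap fun t => smul t.1 (mapWord (t.2 :: ·) (subst φ w))))
          ((l.map fun t => (t.1 : ℝ) * form t.2 v).sum * value (subst φ w) v) v := by
      intro l hl v hv
      induction l with
      | nil => exact (hasDerivAt_const v (0 : ℝ)).congr_deriv (by simp)
      | cons s l ihl =>
        have h1 := (hasDerivAt_value_mapWord (hl s (by simp)) hv).const_mul (s.1 : ℝ)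
        have h2 := ihl fun s hs => hl s (by simp [hs])
        rw [List.flatMap_cons, value_append, value_smul]
        refine (h1.fun_add h2).congr_deriv ?_
        simp only [List.map_cons, List.sum_cons]; ring
    refine eqOn_of_hasDerivAt (f := value (subst φ (x :: w)))
      (g := fun v => polylog (x :: w) (g v)) (l := 0)
      (f' := fun v => form x (g v) * polylog w (g v) * g' v) ?_ ?_ ?_ ?_ hv
    · intro v hv
      refine (hderiv (φ x) hx v hv).congr_deriv ?_
      rw [ih' v hv, ← hform x hxm v hv]; ring
    · intro v hv
      exact (hasDerivAt_polylog hw.1 (hmaps v hv)).comp v (hg v hv)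
    · exact tendsto_value_zero fun t ht => ne_nil_of_mem_subst (by simp) ht
    · refine (tendsto_polylog_zero x w).comp (tendsto_nhdsWithin_iff.mpr ⟨hg0, ?_⟩)
      filter_upwards [Ioo_mem_nhdsGT (show (0 : ℝ) < 1 by norm_num)] with v hv
      exact (hmaps v hv).1

end WordComb

/-! ### Behaviour of power series at 1. -/

theorem tendsto_tsum_mul_pow {c : ℕ → ℝ} (hc : Summable fun n => |c n|) :
    Tendsto (fun v : ℝ => ∑' n, c n * v ^ n) (𝓝[<] 1) (𝓝 (∑' n, c n)) := by
  refine tendsto_tsum_of_dominated_convergence hc (fun n => ?_) ?_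
  · have : Tendsto (fun v : ℝ => c n * v ^ n) (𝓝 1) (𝓝 (c n * 1 ^ n)) :=
      (tendsto_id.pow n).const_mul (c n)
    rw [one_pow, mul_one] at this
    exact this.mono_left nhdsWithin_le_nhds
  · filter_upwards [Ioo_mem_nhdsLT (show (0 : ℝ) < 1 by norm_num)] with v hv n
    rw [norm_mul, Real.norm_eq_abs, Real.norm_eq_abs, abs_of_nonneg (pow_nonneg hv.1.le n)]
    exact mul_le_of_le_one_right (abs_nonneg _) (pow_le_one₀ hv.1.le hv.2.le)

/-- Each of the `n` terms of the geometric sum is at least `v^n`, and the sum times `1 - v` is `1 -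
v^n`. -/
theorem mul_one_sub_mul_pow_le_one {v : ℝ} (h0 : 0 ≤ v) (h1 : v ≤ 1) (n : ℕ) :
    n * (1 - v) * v ^ n ≤ 1 := by
  have h2 : (n : ℝ) * v ^ n ≤ ∑ k ∈ Finset.range n, v ^ k := by
    have h := Finset.card_nsmul_le_sum (Finset.range n) (fun k => v ^ k) (v ^ n) fun k hk =>
      pow_le_pow_of_le_one h0 h1 (Finset.mem_range.mp hk).le
    simpa using h
  have h3 := mul_neg_geom_sum v n
  have h4 : 0 ≤ v ^ n := pow_nonneg h0 n
  nlinarith [mul_le_mul_of_nonneg_left h2 (sub_nonneg.mpr h1)]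

/-- Interpolates between the bounds `1` and `1 / (n (1 - v))`. The exponent `3/8` makes `3/4 + 3/8 =
9/8` summable while staying below the `1/2` of `one_sub_pow_le_rpow`. -/
theorem pow_le_rpow_neg {v : ℝ} (h0 : 0 < v) (h1 : v < 1) {n : ℕ} (hn : 1 ≤ n) :
    v ^ n ≤ (n * (1 - v)) ^ (-(3 / 8) : ℝ) := by
  have hn' : (0 : ℝ) < n := by exact_mod_cast hn
  have ht : 0 < n * (1 - v) := mul_pos hn' (by linarith)
  rcases le_total (n * (1 - v)) 1 with h | h
  · exact (pow_le_one₀ h0.le h1.le).trans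
      (Real.one_le_rpow_of_pos_of_le_one_of_nonpos ht h (by norm_num))
  · calc v ^ n ≤ (n * (1 - v)) ^ (-1 : ℝ) := by
          rw [Real.rpow_neg_one, ← one_div, le_div_iff₀ ht, mul_comm]
          exact mul_one_sub_mul_pow_le_one h0.le h1.le n
      _ ≤ _ := Real.rpow_le_rpow_of_exponent_le h (by norm_num)

/-- Interpolates between Bernoulli's inequality and the bound `1`. The exponent `1/2` keeps `7/4 -
1/2 = 5/4` summable. -/
theorem one_sub_pow_le_rpow {v : ℝ} (h0 : 0 < v) (h1 : v < 1) (n : ℕ) :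
    1 - v ^ n ≤ (n * (1 - v)) ^ (1 / 2 : ℝ) := by
  have ht : 0 ≤ n * (1 - v) := mul_nonneg n.cast_nonneg (by linarith)
  rcases le_total (n * (1 - v)) 1 with h | h
  · have h2 := one_add_mul_le_pow (show (-2 : ℝ) ≤ v - 1 by linarith) n
    rw [add_sub_cancel] at h2
    calc 1 - v ^ n ≤ n * (1 - v) := by linarith
      _ = (n * (1 - v)) ^ (1 : ℝ) := (Real.rpow_one _).symm
      _ ≤ _ := Real.rpow_le_rpow_of_exponent_ge' ht h (by norm_num) (by norm_num)
  · exact (sub_le_self _ (pow_nonneg h0.le n)).trans (Real.one_le_rpow h (by norm_num))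

theorem summable_nat_rpow_neg {s : ℝ} (hs : 1 < s) : Summable fun n : ℕ => (n : ℝ) ^ (-s) :=
  Real.summable_nat_rpow.mpr (by linarith)

/-- Bounds for the power series with coefficients `O(n ^ (-3 / 4))` near `1`. -/
theorem abs_tsum_mul_pow_le {x : ℕ → ℝ} {A : ℝ}
    (hx : ∀ n : ℕ, |x n| ≤ A * (n : ℝ) ^ (-(3 / 4) : ℝ)) {v : ℝ} (hv : v ∈ Set.Ioo (0 : ℝ) 1) :
    |∑' n, x n * v ^ n| ≤ A * (∑' n : ℕ, (n : ℝ) ^ (-(9 / 8) : ℝ)) * (1 - v) ^ (-(3 / 8) : ℝ) := by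
  have hA : 0 ≤ A := by simpa using (abs_nonneg _).trans (hx 1)
  have hv' : 0 ≤ 1 - v := by linarith [hv.2]
  have hs := summable_nat_rpow_neg (show (1 : ℝ) < 9 / 8 by norm_num)
  rw [← tsum_mul_left, ← tsum_mul_right]
  rw [← Real.norm_eq_abs]
  refine tsum_of_norm_bounded ((hs.mul_left A).mul_right _).hasSum fun n => ?_
  rcases Nat.eq_zero_or_pos n with rfl | hn
  · have := hx 0
    have h0 : x 0 = 0 := abs_nonpos_iff.mp (by simpa using this)
    simp [h0]
  · have hn' : (0 : ℝ) < n := by exact_mod_cast hn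
    rw [norm_mul, Real.norm_eq_abs, Real.norm_eq_abs, abs_of_nonneg (pow_nonneg hv.1.le n)]
    calc |x n| * v ^ n ≤ A * (n : ℝ) ^ (-(3 / 4) : ℝ) * (n * (1 - v)) ^ (-(3 / 8) : ℝ) :=
          mul_le_mul (hx n) (pow_le_rpow_neg hv.1 hv.2 hn) (pow_nonneg hv.1.le n) (by positivity)
      _ = A * (n : ℝ) ^ (-(9 / 8) : ℝ) * (1 - v) ^ (-(3 / 8) : ℝ) := by
          rw [Real.mul_rpow hn'.le hv', show (-(9 / 8) : ℝ) = -(3 / 4) + -(3 / 8) by norm_num,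
            Real.rpow_add hn']
          ring

theorem summable_of_abs_le {y : ℕ → ℝ} {B : ℝ}
    (hy : ∀ n : ℕ, |y n| ≤ B * (n : ℝ) ^ (-(7 / 4) : ℝ)) : Summable fun n => |y n| :=
  Summable.of_nonneg_of_le (fun _ => abs_nonneg _) hy
    ((summable_nat_rpow_neg (by norm_num)).mul_left B)

theorem abs_tsum_mul_pow_sub_le {y : ℕ → ℝ} {B : ℝ}
    (hy : ∀ n : ℕ, |y n| ≤ B * (n : ℝ) ^ (-(7 / 4) : ℝ)) {v : ℝ} (hv : v ∈ Set.Ioo (0 : ℝ) 1) :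
    |∑' n, y n * v ^ n - ∑' n, y n| ≤
      B * (∑' n : ℕ, (n : ℝ) ^ (-(5 / 4) : ℝ)) * (1 - v) ^ (1 / 2 : ℝ) := by
  have hB : 0 ≤ B := by simpa using (abs_nonneg _).trans (hy 1)
  have hv' : 0 ≤ 1 - v := by linarith [hv.2]
  have hs := summable_nat_rpow_neg (show (1 : ℝ) < 5 / 4 by norm_num)
  have hy1 := summable_of_abs_le hy
  have hy2 : Summable fun n => y n * v ^ n := by
    refine Summable.of_norm_bounded hy1 fun n => ?_
    rw [norm_mul, Real.norm_eq_abs, Real.norm_eq_abs, abs_of_nonneg (pow_nonneg hv.1.le n)]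
    exact mul_le_of_le_one_right (abs_nonneg _) (pow_le_one₀ hv.1.le hv.2.le)
  rw [← hy2.tsum_sub hy1.of_abs, ← tsum_mul_left, ← tsum_mul_right]
  rw [← Real.norm_eq_abs]
  refine tsum_of_norm_bounded ((hs.mul_left B).mul_right _).hasSum fun n => ?_
  have h1 : v ^ n ≤ 1 := pow_le_one₀ hv.1.le hv.2.le
  rw [Real.norm_eq_abs, abs_sub_comm, show y n - y n * v ^ n = y n * (1 - v ^ n) by ring, abs_mul,
    abs_of_nonneg (sub_nonneg.mpr h1)]
  calc |y n| * (1 - v ^ n) ≤ B * (n : ℝ) ^ (-(7 / 4) : ℝ) * (n * (1 - v)) ^ (1 / 2 : ℝ) :=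
        mul_le_mul (hy n) (one_sub_pow_le_rpow hv.1 hv.2 n) (sub_nonneg.mpr h1) (by positivity)
    _ = B * (n : ℝ) ^ (-(5 / 4) : ℝ) * (1 - v) ^ (1 / 2 : ℝ) := by
        rw [Real.mul_rpow n.cast_nonneg hv']
        rcases Nat.eq_zero_or_pos n with rfl | hn
        · simp
        · have hn' : (0 : ℝ) < n := by exact_mod_cast hn
          rw [show (-(5 / 4) : ℝ) = -(7 / 4) + 1 / 2 by norm_num, Real.rpow_add hn']
          ring

/-- On the tail, split `7/4 = 5/4 + 1/2`: the first part is summed, the second is at most its value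
at `n`. -/
theorem abs_sum_range_sub_tsum_le {y : ℕ → ℝ} {B : ℝ}
    (hy : ∀ n : ℕ, |y n| ≤ B * (n : ℝ) ^ (-(7 / 4) : ℝ)) {N n : ℕ} (hn : 1 ≤ n) (hN : n ≤ N) :
    |∑ k ∈ Finset.range N, y k - ∑' k, y k| ≤
      B * (∑' n : ℕ, (n : ℝ) ^ (-(5 / 4) : ℝ)) * (n : ℝ) ^ (-(1 / 2) : ℝ) := by
  have hB : 0 ≤ B := by simpa using (abs_nonneg _).trans (hy 1)
  have hs := summable_nat_rpow_neg (show (1 : ℝ) < 5 / 4 by norm_num)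
  have hy1 := (summable_of_abs_le hy).of_abs
  have hn' : (0 : ℝ) < n := by exact_mod_cast hn
  rw [← hy1.sum_add_tsum_nat_add N, sub_add_cancel_left, abs_neg]
  have h2 : ‖∑' k, y (k + N)‖ ≤
      ∑' k : ℕ, B * ((k + N : ℕ) : ℝ) ^ (-(5 / 4) : ℝ) * (n : ℝ) ^ (-(1 / 2) : ℝ) := by
    refine tsum_of_norm_bounded
      ((((summable_nat_add_iff N).mpr hs).mul_left B).mul_right _).hasSum fun k => ?_
    have hk : (n : ℝ) ≤ ((k + N : ℕ) : ℝ) := by exact_mod_cast hN.trans (Nat.le_add_left _ _)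
    have hk' : (0 : ℝ) < ((k + N : ℕ) : ℝ) := hn'.trans_le hk
    refine (hy _).trans ?_
    rw [show (-(7 / 4) : ℝ) = -(5 / 4) + -(1 / 2) by norm_num, Real.rpow_add hk', ← mul_assoc]
    refine mul_le_mul_of_nonneg_left ?_ (by positivity)
    exact Real.rpow_le_rpow_of_nonpos hn' hk (by norm_num)
  refine h2.trans ?_
  rw [tsum_mul_right, tsum_mul_left]
  refine mul_le_mul_of_nonneg_right (mul_le_mul_of_nonneg_left ?_ hB) (by positivity)
  have := hs.sum_add_tsum_nat_add N
  have h3 : 0 ≤ ∑ k ∈ Finset.range N, (k : ℝ) ^ (-(5 / 4) : ℝ) :=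
    Finset.sum_nonneg fun _ _ => by positivity
  linarith

theorem abs_sum_range_le {x : ℕ → ℝ} {A : ℝ}
    (hx : ∀ n : ℕ, |x n| ≤ A * (n : ℝ) ^ (-(3 / 4) : ℝ)) (n : ℕ) :
    |∑ k ∈ Finset.range n, x k| ≤ 4 * A * (n : ℝ) ^ (1 / 4 : ℝ) := by
  have hA : 0 ≤ A := by simpa using (abs_nonneg _).trans (hx 1)
  calc |∑ k ∈ Finset.range n, x k| ≤ ∑ k ∈ Finset.range n, |x k| := Finset.abs_sum_le_sum_abs _ _
    _ ≤ ∑ k ∈ Finset.range n, A * (k : ℝ) ^ (-(3 / 4) : ℝ) := Finset.sum_le_sum fun k _ => hx k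
    _ = A * ∑ k ∈ Finset.range n, (k : ℝ) ^ (-(3 / 4) : ℝ) := by rw [Finset.mul_sum]
    _ ≤ A * (4 * (n : ℝ) ^ (1 / 4 : ℝ)) := by gcongr; exact Word.sum_rpow_le' n
    _ = _ := by ring

/-- The power series whose partial sums are the products of the partial sums of two series differs
from the product of the two power series by a term that vanishes at `1`. -/
theorem tendsto_mul_sub_tsum_mul_pow {x y : ℕ → ℝ} {A B : ℝ}
    (hx : ∀ n : ℕ, |x n| ≤ A * (n : ℝ) ^ (-(3 / 4) : ℝ))
    (hy : ∀ n : ℕ, |y n| ≤ B * (n : ℝ) ^ (-(7 / 4) : ℝ)) :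
    Tendsto (fun v : ℝ => (∑' n, x n * v ^ n) * (∑' n, y n * v ^ n) -
      ∑' n, ((∑ k ∈ Finset.range (n + 1), x k) * (∑ k ∈ Finset.range (n + 1), y k) -
        (∑ k ∈ Finset.range n, x k) * (∑ k ∈ Finset.range n, y k)) * v ^ n) (𝓝[<] 1) (𝓝 0) := by
  have hA : 0 ≤ A := by simpa using (abs_nonneg _).trans (hx 1)
  have hB : 0 ≤ B := by simpa using (abs_nonneg _).trans (hy 1)
  set ζ := ∑' n, y n with hζ
  set X := fun n => ∑ k ∈ Finset.range n, x k with hX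
  set Y := fun n => ∑ k ∈ Finset.range n, y k with hY
  set C := ∑' n : ℕ, (n : ℝ) ^ (-(5 / 4) : ℝ) with hC
  have hC0 : 0 ≤ C := tsum_nonneg fun _ => by positivity
  have hs := summable_nat_rpow_neg (show (1 : ℝ) < 5 / 4 by norm_num)
  have hx0 : x 0 = 0 := abs_nonpos_iff.mp (by simpa using hx 0)
  -- Centring `Y` at its limit makes the increments absolutely summable. They telescope to total 0,
  -- since `X n = O(n^(1/4))` and `Y n - ζ = O(n^(-1/2))`.
  set e := fun n => X (n + 1) * (Y (n + 1) - ζ) - X n * (Y n - ζ) with he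
  have he' : ∀ n, e n = x n * (Y (n + 1) - ζ) + X n * y n := by
    intro n
    simp only [he, hX, hY, Finset.sum_range_succ]; ring
  have hebd : ∀ n : ℕ, |e n| ≤ (A * (B * C) + 4 * A * B) * (n : ℝ) ^ (-(5 / 4) : ℝ) := by
    intro n
    rcases Nat.eq_zero_or_pos n with rfl | hn
    · rw [he']; simp [hx0, hX]
    have hn' : (0 : ℝ) < n := by exact_mod_cast hn
    have hn1 : (1 : ℝ) ≤ n := by exact_mod_cast hn
    have h1 : |x n * (Y (n + 1) - ζ)| ≤ A * (B * C) * (n : ℝ) ^ (-(5 / 4) : ℝ) := by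
      rw [abs_mul, show (-(5 / 4) : ℝ) = -(3 / 4) + -(1 / 2) by norm_num, Real.rpow_add hn']
      calc _ ≤ A * (n : ℝ) ^ (-(3 / 4) : ℝ) * (B * C * (n : ℝ) ^ (-(1 / 2) : ℝ)) :=
            mul_le_mul (hx n) (abs_sum_range_sub_tsum_le hy hn n.le_succ) (abs_nonneg _)
              (by positivity)
        _ = _ := by ring
    have h2 : |X n * y n| ≤ 4 * A * B * (n : ℝ) ^ (-(5 / 4) : ℝ) := by
      rw [abs_mul]
      calc _ ≤ 4 * A * (n : ℝ) ^ (1 / 4 : ℝ) * (B * (n : ℝ) ^ (-(7 / 4) : ℝ)) :=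
            mul_le_mul (abs_sum_range_le hx n) (hy n) (abs_nonneg _) (by positivity)
        _ = 4 * A * B * (n : ℝ) ^ (-(6 / 4) : ℝ) := by
            rw [show (-(6 / 4) : ℝ) = 1 / 4 + -(7 / 4) by norm_num, Real.rpow_add hn']; ring
        _ ≤ _ := by
            refine mul_le_mul_of_nonneg_left ?_ (by positivity)
            exact Real.rpow_le_rpow_of_exponent_le hn1 (by norm_num)
    rw [he', add_mul]
    exact (abs_add_le _ _).trans (add_le_add h1 h2)
  have hesum : Summable fun n => |e n| :=
    Summable.of_nonneg_of_le (fun _ => abs_nonneg _) hebd (hs.mul_left _)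
  have hE : Tendsto (fun n => X n * (Y n - ζ)) atTop (𝓝 0) := by
    have h0 : Tendsto (fun n : ℕ => 4 * A * (B * C) * (n : ℝ) ^ (-(1 / 4) : ℝ)) atTop (𝓝 0) := by
      simpa using ((tendsto_rpow_neg_atTop (show (0 : ℝ) < 1 / 4 by norm_num)).comp
        tendsto_natCast_atTop_atTop).const_mul (4 * A * (B * C))
    refine squeeze_zero_norm' ?_ h0
    filter_upwards [eventually_ge_atTop 1] with n hn
    have hn' : (0 : ℝ) < n := by exact_mod_cast hn
    rw [norm_mul]
    calc _ ≤ 4 * A * (n : ℝ) ^ (1 / 4 : ℝ) * (B * C * (n : ℝ) ^ (-(1 / 2) : ℝ)) :=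
          mul_le_mul (abs_sum_range_le hx n) (abs_sum_range_sub_tsum_le hy hn le_rfl)
            (abs_nonneg _) (by positivity)
      _ = _ := by
          rw [show (-(1 / 4) : ℝ) = 1 / 4 + -(1 / 2) by norm_num, Real.rpow_add hn']; ring
  have he0 : ∑' n, e n = 0 := by
    have h1 := hesum.of_abs.hasSum.tendsto_sum_nat
    have h2 : ∀ n, ∑ k ∈ Finset.range n, e k = X n * (Y n - ζ) := by
      intro n
      simp only [he]
      rw [Finset.sum_range_sub (fun n => X n * (Y n - ζ))]
      simp [hX]
    simp_rw [h2] at h1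
    exact tendsto_nhds_unique h1 hE
  have hlim1 := tendsto_tsum_mul_pow hesum
  rw [he0] at hlim1
  -- The first factor grows at most like `(1 - v)^(-3/8)` and the second decays like `(1 -
  -- v)^(1/2)`, which leaves `(1 - v)^(1/8)`.
  have hlim2 : Tendsto (fun v : ℝ => (∑' n, x n * v ^ n) * (∑' n, y n * v ^ n - ζ))
      (𝓝[<] 1) (𝓝 0) := by
    set D := ∑' n : ℕ, (n : ℝ) ^ (-(9 / 8) : ℝ) with hD
    have h0 : Tendsto (fun v : ℝ => A * D * (B * C) * (1 - v) ^ (1 / 8 : ℝ)) (𝓝[<] 1) (𝓝 0) := by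
      have : Tendsto (fun v : ℝ => A * D * (B * C) * (1 - v) ^ (1 / 8 : ℝ)) (𝓝 1)
          (𝓝 (A * D * (B * C) * (1 - 1) ^ (1 / 8 : ℝ))) := by
        refine Tendsto.const_mul _ (Tendsto.rpow_const ?_ (Or.inr (by norm_num)))
        exact tendsto_const_nhds.sub tendsto_id
      rw [sub_self, Real.zero_rpow (by norm_num), mul_zero] at this
      exact this.mono_left nhdsWithin_le_nhds
    refine squeeze_zero_norm' ?_ h0
    filter_upwards [Ioo_mem_nhdsLT (show (0 : ℝ) < 1 by norm_num)] with v hv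
    have hv' : 0 < 1 - v := by linarith [hv.2]
    rw [norm_mul]
    calc _ ≤ A * D * (1 - v) ^ (-(3 / 8) : ℝ) * (B * C * (1 - v) ^ (1 / 2 : ℝ)) :=
          mul_le_mul (abs_tsum_mul_pow_le hx hv) (abs_tsum_mul_pow_sub_le hy hv) (abs_nonneg _)
            ((abs_nonneg _).trans (abs_tsum_mul_pow_le hx hv))
      _ = _ := by
          rw [show (1 / 8 : ℝ) = -(3 / 8) + 1 / 2 by norm_num, Real.rpow_add hv']; ring
  have hlim := hlim2.sub hlim1
  rw [sub_zero] at hlim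
  refine hlim.congr' ?_
  filter_upwards [Ioo_mem_nhdsLT (show (0 : ℝ) < 1 by norm_num)] with v hv
  have hv1 : |v| < 1 := by rw [abs_of_pos hv.1]; exact hv.2
  have hxs : Summable fun n => x n * v ^ n := by
    refine (Word.summable_norm_mul_pow (K := A) (fun n => (hx n).trans ?_) hv1).of_norm
    refine mul_le_of_le_one_right hA ?_
    rcases Nat.eq_zero_or_pos n with rfl | hn
    · simp
    · exact Real.rpow_le_one_of_one_le_of_nonpos (by exact_mod_cast hn) (by norm_num)
  have hes : Summable fun n => e n * v ^ n := by
    refine Summable.of_norm_bounded hesum fun n => ?_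
    rw [norm_mul, Real.norm_eq_abs, Real.norm_eq_abs, abs_of_nonneg (pow_nonneg hv.1.le n)]
    exact mul_le_of_le_one_right (abs_nonneg _) (pow_le_one₀ hv.1.le hv.2.le)
  -- Undoes the centring: the increments of `X * Y` are `e + ζ * x`.
  have hd : ∑' n, (X (n + 1) * Y (n + 1) - X n * Y n) * v ^ n =
      ∑' n, e n * v ^ n + ζ * ∑' n, x n * v ^ n := by
    rw [← tsum_mul_left, ← hes.tsum_add (hxs.mul_left ζ)]
    refine tsum_congr fun n => ?_
    simp only [he, hX, Finset.sum_range_succ]; ring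
  rw [hd]; ring

/-! ### Nested alternating sums and the quasi-shuffle product. -/

/-- Indices of a nested alternating sum: the entry `(k, e)` stands for `(±1) ^ n / n ^ (k + 1)`, with
the sign `-1` if `e` holds; the head belongs to the largest summation variable. -/
abbrev SignedIndex := List (ℕ × Bool)

namespace SignedIndex

open Word

/-- The sign encoded by a Boolean. -/
def sign (e : Bool) : ℤ := if e then -1 else 1

/-- The word of a nested alternating sum; `c` is the product of the signs read so far. -/
def toWord : Bool → SignedIndex → Word
  | _, [] => []
  | c, (k, e) :: l =>
    List.replicate k .o ++ (if xor c e then .m else .p) :: toWord (xor c e) l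

/-- The sign relating a nested alternating sum to its word. -/
def wordSign : Bool → SignedIndex → ℤ
  | _, [] => 1
  | c, (_, e) :: l => sign (xor c e) * wordSign (xor c e) l

/-- The part of a nested alternating sum in which the largest variable is `n`. -/
noncomputable def term : SignedIndex → ℕ → ℝ
  | [], n => if n = 0 then 1 else 0
  | (k, e) :: l, n => (sign e : ℝ) ^ n / (n : ℝ) ^ (k + 1) * ∑ j ∈ Finset.range n, term l j

/-- The nested alternating sum over variables less than `N`. -/
noncomputable def partialSum (l : SignedIndex) (N : ℕ) : ℝ := ∑ n ∈ Finset.range N, term l n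

theorem term_cons_zero (i : ℕ × Bool) (l : SignedIndex) : term (i :: l) 0 = 0 := by
  simp [term]

theorem coef_replicate_append (k : ℕ) (w : Word) (n : ℕ) :
    coef (List.replicate k .o ++ w) n = coef w n / (n : ℝ) ^ k := by
  induction k with
  | zero => simp
  | succ k ih =>
    rw [List.replicate_succ, List.cons_append, coef, ih, pow_succ, div_div]

/-- The alternation in the kernel of `m` depends on differences of consecutive variables, so the
letters record cumulative products of signs. Passing the sign from `n` down to the next variable
costs a factor `-1` per letter `m`, collected in `wordSign`. -/
theorem coef_toWord (c : Bool) (l : SignedIndex) (n : ℕ) :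
    wordSign c l * coef (toWord c l) n = (sign c : ℝ) ^ n * term l n := by
  induction l generalizing c n with
  | nil => by_cases h : n = 0 <;> simp [wordSign, toWord, coef, term, h]
  | cons i l ih =>
    obtain ⟨k, e⟩ := i
    rw [toWord, coef_replicate_append, wordSign, term, ← mul_assoc, ← mul_div_assoc,
      ← mul_div_assoc, ← mul_pow]
    have hs : (sign c : ℝ) * sign e = sign (xor c e) := by
      cases c <;> cases e <;> simp [sign]
    rw [hs]
    cases hc : xor c e with
    | false =>
      have ih' := ih false
      simp only [sign, Bool.false_eq_true, if_false, Int.cast_one, one_pow, one_mul] at ih' ⊢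
      simp only [coef, Finset.mul_sum, mul_div_assoc', Finset.sum_div]
      refine Finset.sum_congr rfl fun j _ => ?_
      rw [← ih' j, pow_succ', ← div_div]; ring
    | true =>
      have ih' := ih true
      simp only [sign, if_true, Int.cast_neg, Int.cast_one] at ih' ⊢
      simp only [coef, Finset.mul_sum, mul_div_assoc', Finset.sum_div]
      refine Finset.sum_congr rfl fun j hj => ?_
      have hj' := Finset.mem_range.mp hj
      have h1 : (-1 : ℝ) ^ n = (-1) ^ (n - 1 - j) * (-1) ^ j * (-1) := by
        rw [← pow_add, ← pow_succ]; congr 1; omega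
      have h2 : ((-1 : ℝ) ^ j) * (-1) ^ j = 1 := by rw [← mul_pow]; norm_num
      rw [h1, show (-1 : ℝ) ^ (n - 1 - j) * (-1) ^ j * (-1) / (n : ℝ) ^ (k + 1) * term l j =
        (-1 : ℝ) ^ (n - 1 - j) * (-1) / (n : ℝ) ^ (k + 1) * ((-1) ^ j * term l j) by ring,
        ← ih' j, pow_succ']
      push_cast
      rw [← div_div]; ring

theorem wordSign_mul_self (c : Bool) (l : SignedIndex) :
    (wordSign c l : ℝ) * wordSign c l = 1 := by
  induction l generalizing c with
  | nil => simp [wordSign]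
  | cons i l ih =>
    obtain ⟨k, e⟩ := i
    have h := ih (xor c e)
    have hs : (sign (xor c e) : ℝ) * sign (xor c e) = 1 := by
      cases xor c e <;> simp [sign]
    rw [wordSign]; push_cast
    linear_combination (wordSign (xor c e) l : ℝ) * wordSign (xor c e) l * hs + h

theorem abs_term (l : SignedIndex) (n : ℕ) : |term l n| = |coef (toWord false l) n| := by
  have h := coef_toWord false l n
  have h1 : |(wordSign false l : ℝ)| = 1 := by
    have := wordSign_mul_self false l
    rw [← abs_mul_abs_self] at this
    nlinarith [abs_nonneg (wordSign false l : ℝ)]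
  simp only [sign, Bool.false_eq_true, if_false, Int.cast_one, one_pow, one_mul] at h
  rw [← h, abs_mul, h1, one_mul]

theorem proper_toWord (c : Bool) (l : SignedIndex) : proper (toWord c l) := by
  induction l generalizing c with
  | nil => rfl
  | cons i l ih =>
    obtain ⟨k, e⟩ := i
    rw [toWord]
    induction k with
    | zero => cases hc : xor c e <;> simp [proper, ih]
    | succ k ihk =>
      rw [List.replicate_succ, List.cons_append, proper_cons]
      exact ⟨fun _ => by simp, ihk⟩

theorem abs_term_le {l : SignedIndex} (hl : l ≠ []) :
    ∃ A : ℝ, ∀ n : ℕ, |term l n| ≤ A * (n : ℝ) ^ (-(3 / 4) : ℝ) := by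
  refine ⟨4 ^ (toWord false l).length, fun n => ?_⟩
  rcases Nat.eq_zero_or_pos n with rfl | hn
  · rcases l with _ | ⟨i, l⟩
    · exact absurd rfl hl
    · rw [term_cons_zero]; simp
  · rw [abs_term]; exact abs_coef_le _ n hn

/-- A leading exponent of at least 2 gains a factor `1/n`, hence absolute convergence. -/
theorem abs_term_succ_le (k : ℕ) (e : Bool) (l : SignedIndex) :
    ∃ B : ℝ, ∀ n : ℕ, |term ((k + 1, e) :: l) n| ≤ B * (n : ℝ) ^ (-(7 / 4) : ℝ) := by
  obtain ⟨A, hA⟩ := abs_term_le (l := (k, e) :: l) (by simp)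
  refine ⟨A, fun n => ?_⟩
  rcases Nat.eq_zero_or_pos n with rfl | hn
  · rw [term_cons_zero]; simp
  have hn' : (0 : ℝ) < n := by exact_mod_cast hn
  have h : term ((k + 1, e) :: l) n = term ((k, e) :: l) n / n := by
    simp only [term, pow_succ]; field_simp
  rw [h, abs_div, Nat.abs_cast, div_le_iff₀ hn', mul_assoc, ← Real.rpow_add_one hn'.ne',
    show (-(7 / 4) + 1 : ℝ) = -(3 / 4) by norm_num]
  exact hA n

/-- Auxiliary recursion for `stuffle`, along the second index. -/
def stuffleAux (i : ℕ × Bool) (u : SignedIndex) (f : SignedIndex → List SignedIndex) :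
    SignedIndex → List SignedIndex
  | [] => [i :: u]
  | j :: w => (f (j :: w)).map (i :: ·) ++ (stuffleAux i u f w).map (j :: ·) ++
      (f w).map ((i.1 + j.1 + 1, xor i.2 j.2) :: ·)

/-- The quasi-shuffle product of nested sums. -/
def stuffle : SignedIndex → SignedIndex → List SignedIndex
  | [] => fun w => [w]
  | i :: u => stuffleAux i u (stuffle u)

theorem stuffle_nil_right (u : SignedIndex) : stuffle u [] = [u] := by
  cases u <;> rfl

theorem stuffle_cons_cons (i j : ℕ × Bool) (u w : SignedIndex) :
    stuffle (i :: u) (j :: w) =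
      (stuffle u (j :: w)).map (i :: ·) ++ (stuffle (i :: u) w).map (j :: ·) ++
        (stuffle u w).map ((i.1 + j.1 + 1, xor i.2 j.2) :: ·) := rfl

theorem partialSum_succ (l : SignedIndex) (N : ℕ) :
    partialSum l (N + 1) = partialSum l N + term l N := Finset.sum_range_succ _ _

theorem partialSum_nil (N : ℕ) : partialSum [] (N + 1) = 1 := by
  rw [partialSum, Finset.sum_eq_single 0]
  · simp [term]
  · intro b _ hb; simp [term, hb]
  · simp

theorem sum_map_term_cons (i : ℕ × Bool) (L : List SignedIndex) (n : ℕ) :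
    ((L.map (i :: ·)).map fun t => term t n).sum =
      (sign i.2 : ℝ) ^ n / (n : ℝ) ^ (i.1 + 1) * (L.map fun t => partialSum t n).sum := by
  induction L with
  | nil => simp
  | cons t L ih =>
    simp only [List.map_cons, List.sum_cons, mul_add] at ih ⊢
    rw [ih]; rfl

theorem sum_map_partialSum_succ (L : List SignedIndex) (N : ℕ) :
    (L.map fun t => partialSum t (N + 1)).sum =
      (L.map fun t => partialSum t N).sum + (L.map fun t => term t N).sum := by
  simp [partialSum_succ, List.sum_map_add]

/-- The increment of a product of partial sums is `aB + Ab + ab`. These are the three groups of the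
quasi-shuffle: the largest variable comes from `u`, from `w`, or from both at once. -/
theorem partialSum_mul_partialSum (u w : SignedIndex) (N : ℕ) :
    partialSum u N * partialSum w N = ((stuffle u w).map fun t => partialSum t N).sum := by
  induction u generalizing w N with
  | nil =>
    cases N with
    | zero => simp [stuffle, partialSum]
    | succ N => simp [stuffle, partialSum_nil]
  | cons i u ihu =>
    induction w generalizing N with
    | nil =>
      cases N with
      | zero => simp [stuffle_nil_right, partialSum]
      | succ N => simp [stuffle_nil_right, partialSum_nil]
    | cons j w ihw =>
      induction N with
      | zero => simp [partialSum]
      | succ N ihN =>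
        rw [sum_map_partialSum_succ, ← ihN, stuffle_cons_cons, List.map_append, List.sum_append,
          List.map_append, List.sum_append, sum_map_term_cons, sum_map_term_cons,
          sum_map_term_cons, ← ihu, ← ihu, ← ihw, partialSum_succ, partialSum_succ]
        have hs : (sign (xor i.2 j.2) : ℝ) = sign i.2 * sign j.2 := by
          cases i.2 <;> cases j.2 <;> simp [sign]
        have h1 : term (i :: u) N =
            (sign i.2 : ℝ) ^ N / (N : ℝ) ^ (i.1 + 1) * partialSum u N := rfl
        have h2 : term (j :: w) N =
            (sign j.2 : ℝ) ^ N / (N : ℝ) ^ (j.1 + 1) * partialSum w N := rfl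
        have h3 : (sign i.2 : ℝ) ^ N * (sign j.2 : ℝ) ^ N / (N : ℝ) ^ (i.1 + j.1 + 1 + 1) =
            (sign i.2 : ℝ) ^ N / (N : ℝ) ^ (i.1 + 1) * ((sign j.2 : ℝ) ^ N / (N : ℝ) ^ (j.1 + 1)) := by
          rw [show i.1 + j.1 + 1 + 1 = (i.1 + 1) + (j.1 + 1) by ring, pow_add, mul_div_mul_comm]
        rw [h1, h2, hs, mul_pow, h3]
        ring

theorem sum_map_term (L : List SignedIndex) (N : ℕ) :
    (L.map fun t => term t N).sum =
      (L.map fun t => partialSum t (N + 1)).sum - (L.map fun t => partialSum t N).sum := by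
  rw [sum_map_partialSum_succ]; ring

/-- A nested sum as a combination of words. -/
def toComb (l : SignedIndex) : ℤ × Word := (wordSign false l, toWord false l)

theorem summable_term_mul_pow (l : SignedIndex) {v : ℝ} (hv : v ∈ Set.Ioo (0 : ℝ) 1) :
    Summable fun n => term l n * v ^ n :=
  (summable_norm_mul_pow (K := 4 ^ (toWord false l).length)
    (fun n => by rw [abs_term]; exact abs_coef_le_const _ n)
    (by rw [abs_of_pos hv.1]; exact hv.2)).of_norm

theorem wordSign_mul_polylog (l : SignedIndex) (v : ℝ) :
    wordSign false l * polylog (toWord false l) v = ∑' n, term l n * v ^ n := by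
  rw [polylog, ← tsum_mul_left]
  refine tsum_congr fun n => ?_
  have h := coef_toWord false l n
  simp only [sign, Bool.false_eq_true, if_false, Int.cast_one, one_pow, one_mul] at h
  rw [← h]; ring

theorem value_map_toComb (L : List SignedIndex) {v : ℝ} (hv : v ∈ Set.Ioo (0 : ℝ) 1) :
    WordComb.value (L.map toComb) v = ∑' n, (L.map fun t => term t n).sum * v ^ n := by
  induction L with
  | nil => simp [WordComb.value_nil]
  | cons l L ih =>
    have hL : Summable fun n => (L.map fun t => term t n).sum * v ^ n := by
      clear ih
      induction L with
      | nil => simp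
      | cons l L ih =>
        refine ((summable_term_mul_pow l hv).add ih).congr fun n => ?_
        simp only [List.map_cons, List.sum_cons]; ring
    rw [List.map_cons, WordComb.value_cons]
    simp only
    rw [ih, toComb]
    simp only
    rw [wordSign_mul_polylog, ← (summable_term_mul_pow l hv).tsum_add hL]
    refine tsum_congr fun n => ?_
    simp only [List.map_cons, List.sum_cons]; ring

end SignedIndex

/-! ### Values at 1, double shuffle relations and distribution relations. -/

namespace WordComb

open Word

/-- The combination has the value `x` at `1`. -/
def HasValue (r : WordComb) (x : ℝ) : Prop := Tendsto (value r) (𝓝[<] 1) (𝓝 x)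

theorem HasValue.congr {r : WordComb} {f : ℝ → ℝ} {x : ℝ} (hf : Tendsto f (𝓝[<] 1) (𝓝 x))
    (h : ∀ v ∈ Set.Ioo (0 : ℝ) 1, f v = value r v) : HasValue r x := by
  refine hf.congr' ?_
  filter_upwards [Ioo_mem_nhdsLT (show (0 : ℝ) < 1 by norm_num)] with v hv using h v hv

theorem HasValue.append {r s : WordComb} {x y : ℝ} (hr : HasValue r x) (hs : HasValue s y) :
    HasValue (r ++ s) (x + y) := by
  rw [HasValue, value_append]; exact hr.add hs

theorem HasValue.smul {r : WordComb} {x : ℝ} (hr : HasValue r x) (c : ℤ) :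
    HasValue (smul c r) (c * x) := by
  rw [HasValue, value_smul]; exact hr.const_mul _

theorem hasValue_nil : HasValue [] 0 := tendsto_const_nhds

theorem HasValue.mul {r s : WordComb} {x y : ℝ} (hr : HasValue r x) (hs : HasValue s y)
    (hr' : isProper r) (hs' : isProper s) : HasValue (mul r s) (x * y) :=
  HasValue.congr (Tendsto.mul hr hs) fun _ hv => (value_mul hr' hs' hv).symm

/-- The outer `o` contributes a factor `1/n`, so the coefficients are absolutely summable. -/
theorem hasValue_cons_o (w : Word) : HasValue [(1, .o :: w)] (∑' n, coef (.o :: w) n) := by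
  refine HasValue.congr (tendsto_tsum_mul_pow ?_) fun v _ => ?_
  · refine summable_of_abs_le (B := 4 ^ w.length) fun n => ?_
    rcases Nat.eq_zero_or_pos n with rfl | hn
    · rw [coef_cons_zero]; simp
    have hn' : (0 : ℝ) < n := by exact_mod_cast hn
    rw [coef, abs_div, Nat.abs_cast, div_le_iff₀ hn', mul_assoc, ← Real.rpow_add_one hn'.ne',
      show (-(7 / 4) + 1 : ℝ) = -(3 / 4) by norm_num]
    exact abs_coef_le w n hn
  · simp [value_cons, value_nil, polylog]

theorem hasValue_log_two : HasValue [(1, [.m])] (Real.log 2) := by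
  have hd : ∀ v ∈ Set.Ioo (0 : ℝ) 1,
      HasDerivAt (fun v : ℝ => Real.log (1 + v)) (form .m v * polylog [] v) v := by
    intro v hv
    have h := ((hasDerivAt_id v).const_add 1).log (by have := hv.1; simp only [id]; linarith)
    simpa [form, polylog_nil] using h
  have hc : ∀ a : ℝ, 0 ≤ a → Tendsto (fun v : ℝ => Real.log (1 + v)) (𝓝 a) (𝓝 (Real.log (1 + a))) :=
    fun a ha => (tendsto_const_nhds.add tendsto_id).log (by linarith)
  have heq := eqOn_of_hasDerivAt hd (fun v hv => hasDerivAt_polylog (x := .m) (by simp) hv)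
    (l := 0) (by simpa using (hc 0 le_rfl).mono_left nhdsWithin_le_nhds)
    (tendsto_polylog_zero .m [])
  have h1 := (hc 1 zero_le_one).mono_left (nhdsWithin_le_nhds (s := Set.Iio 1))
  rw [show (1 : ℝ) + 1 = 2 by norm_num] at h1
  refine HasValue.congr h1 fun v hv => ?_
  have := heq hv
  simp only at this
  rw [this]; simp [value_cons, value_nil]

/-- The difference of the shuffle product and the quasi-shuffle product. -/
def stuffleRel (u w : SignedIndex) : WordComb :=
  ofList (SignedIndex.wordSign false u * SignedIndex.wordSign false w)
    (shuffle (SignedIndex.toWord false u) (SignedIndex.toWord false w)) ++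
  smul (-1) ((SignedIndex.stuffle u w).map SignedIndex.toComb)

/-- On `(0, 1)` the shuffles give the product of the two power series; the quasi-shuffles give the
series whose partial coefficient sums are the products of partial sums. The first factor may diverge
at 1 because the second converges fast enough. -/
theorem hasValue_stuffleRel {u : SignedIndex} (hu : u ≠ []) (k : ℕ) (e : Bool) (w : SignedIndex) :
    HasValue (stuffleRel u ((k + 1, e) :: w)) 0 := by
  obtain ⟨A, hA⟩ := SignedIndex.abs_term_le hu
  obtain ⟨B, hB⟩ := SignedIndex.abs_term_succ_le k e w
  refine HasValue.congr (tendsto_mul_sub_tsum_mul_pow hA hB) fun v hv => ?_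
  rw [stuffleRel, value_append, value_smul]
  simp only
  rw [SignedIndex.value_map_toComb _ hv, value, eval_ofList,
    ← polylog_mul_polylog (SignedIndex.proper_toWord _ _) (SignedIndex.proper_toWord _ _) hv,
    ← SignedIndex.wordSign_mul_polylog, ← SignedIndex.wordSign_mul_polylog]
  simp only [SignedIndex.sum_map_term, ← SignedIndex.partialSum_mul_partialSum]
  push_cast
  simp only [SignedIndex.partialSum]
  ring

/-- The substitution `t ↦ t ^ 2`. -/
def squareSubst : Letter → List (ℤ × Letter)
  | .o => [(2, .o)]
  | .p => [(1, .p), (-1, .m)]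
  | .m => []

/-- The words in the letters `o` and `p`. -/
def isPositive : Word → Bool
  | [] => true
  | .o :: w => isPositive w
  | .p :: w => isPositive w
  | .m :: _ => false

theorem ne_m_of_isPositive {w : Word} (hw : isPositive w) : ∀ x ∈ w, x ≠ .m := by
  induction w with
  | nil => simp
  | cons x w ih =>
    cases x with
    | m => simp [isPositive] at hw
    | o => simpa using ih hw
    | p => simpa using ih hw

/-- With `s = t^2`, `ds/s = 2 dt/t` and `ds/(1 - s) = dt/(1 - t) - dt/(1 + t)`. -/
theorem value_squareSubst {w : Word} (hw : proper w) (hm : isPositive w) {v : ℝ}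
    (hv : v ∈ Set.Ioo (0 : ℝ) 1) : value (subst squareSubst w) v = polylog w (v ^ 2) := by
  refine value_subst (g := fun v => v ^ 2) (g' := fun v => 2 * v) ?_ ?_ ?_ ?_ ?_ hw
    (ne_m_of_isPositive hm) hv
  · intro v _; simpa using hasDerivAt_pow 2 v
  · intro v hv; exact ⟨pow_pos hv.1 2, pow_lt_one₀ hv.1.le hv.2 (by norm_num)⟩
  · have : Tendsto (fun v : ℝ => v ^ 2) (𝓝 0) (𝓝 (0 ^ 2)) := tendsto_id.pow 2
    simpa using this.mono_left nhdsWithin_le_nhds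
  · simp [squareSubst]
  · intro x hx v hv
    have h1 := hv.1.ne'
    have h2 : 1 - v ≠ 0 := by have := hv.2; intro h; linarith
    have h3 : 1 + v ≠ 0 := by have := hv.1; intro h; linarith
    have h4 : 1 - v ^ 2 ≠ 0 := by
      rw [show 1 - v ^ 2 = (1 - v) * (1 + v) by ring]; exact mul_ne_zero h2 h3
    cases x with
    | o => simp only [squareSubst, form, List.map_cons, List.map_nil, List.sum_cons,
        List.sum_nil]; push_cast; field_simp; ring
    | p =>
      simp only [squareSubst, form, List.map_cons, List.map_nil, List.sum_cons, List.sum_nil]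
      rw [show 1 - v ^ 2 = (1 - v) * (1 + v) by ring]; push_cast; field_simp; ring
    | m => exact absurd rfl hx

/-- The distribution relation of a word. -/
def squareRel (w : Word) : WordComb := subst squareSubst w ++ [(-1, w)]

/-- The leading `o` gives a finite limit at 1, and `v` and `v^2` approach 1 together. -/
theorem hasValue_squareRel {w : Word} (hw : proper (.o :: w)) (hm : isPositive (.o :: w)) :
    HasValue (squareRel (.o :: w)) 0 := by
  have h1 : Tendsto (polylog (.o :: w)) (𝓝[<] 1) (𝓝 (∑' n, coef (.o :: w) n)) := by
    have := hasValue_cons_o w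
    simpa [HasValue, value_cons, value_nil] using this
  have h2 : Tendsto (fun v : ℝ => v ^ 2) (𝓝[<] 1) (𝓝[<] 1) := by
    refine tendsto_nhdsWithin_iff.mpr ⟨?_, ?_⟩
    · have : Tendsto (fun v : ℝ => v ^ 2) (𝓝 1) (𝓝 (1 ^ 2)) := tendsto_id.pow 2
      simpa using this.mono_left nhdsWithin_le_nhds
    · filter_upwards [Ioo_mem_nhdsLT (show (0 : ℝ) < 1 by norm_num)] with v hv
      exact pow_lt_one₀ hv.1.le hv.2 (by norm_num)
  have h3 := (h1.comp h2).sub h1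
  rw [sub_self] at h3
  refine HasValue.congr h3 fun v hv => ?_
  rw [squareRel, value_append]
  simp only
  rw [value_squareSubst hw hm hv]
  simp [value_cons, value_nil]
  ring

end WordComb

/-! ### Polylogarithms at 1/2, zeta values and the Landen substitution. -/

namespace WordComb

open Word

/-- The substitution `t ↦ t / (1 + t)`. -/
def halfSubst : Letter → List (ℤ × Letter)
  | .o => [(1, .o), (-1, .m)]
  | .p => [(1, .m)]
  | .m => []

/-- With `s = t / (1 + t)`, `ds/s = dt/t - dt/(1 + t)` and `ds/(1 - s) = dt/(1 + t)`. The endpoint 1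
goes to `1/2`. -/
theorem value_halfSubst {w : Word} (hw : proper w) (hm : isPositive w) {v : ℝ}
    (hv : v ∈ Set.Ioo (0 : ℝ) 1) : value (subst halfSubst w) v = polylog w (v / (1 + v)) := by
  refine value_subst (g := fun v => v / (1 + v)) (g' := fun v => 1 / (1 + v) ^ 2) ?_ ?_ ?_ ?_ ?_ hw
    (ne_m_of_isPositive hm) hv
  · intro v hv
    have h3 : 1 + v ≠ 0 := by have := hv.1; intro h; linarith
    refine ((hasDerivAt_id v).fun_div ((hasDerivAt_id v).const_add 1) h3).congr_deriv ?_
    simp only [id]; field_simp; ring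
  · intro v hv
    have h3 : 0 < 1 + v := by linarith [hv.1]
    exact ⟨div_pos hv.1 h3, by rw [div_lt_one h3]; linarith⟩
  · have : Tendsto (fun v : ℝ => v / (1 + v)) (𝓝 0) (𝓝 (0 / (1 + 0))) :=
      tendsto_id.div (tendsto_const_nhds.add tendsto_id) (by norm_num)
    rw [zero_div] at this
    exact this.mono_left nhdsWithin_le_nhds
  · simp [halfSubst]
  · intro x hx v hv
    have h1 := hv.1.ne'
    have h3 : 1 + v ≠ 0 := by have := hv.1; intro h; linarith
    cases x with
    | o =>
      simp only [halfSubst, form, List.map_cons, List.map_nil, List.sum_cons, List.sum_nil]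
      push_cast; field_simp; ring
    | p =>
      simp only [halfSubst, form, List.map_cons, List.map_nil, List.sum_cons, List.sum_nil]
      rw [show 1 - v / (1 + v) = 1 / (1 + v) by field_simp; ring]; push_cast; field_simp; ring
    | m => exact absurd rfl hx

theorem coef_replicate_p (k n : ℕ) :
    coef (List.replicate k .o ++ [.p]) n = 1 / (n : ℝ) ^ (k + 1) := by
  rw [SignedIndex.coef_replicate_append]
  rcases Nat.eq_zero_or_pos n with rfl | hn
  · simp [coef]
  · have : ∑ k ∈ Finset.range n, coef [] k = 1 := by
      obtain ⟨m, rfl⟩ : ∃ m, n = m + 1 := ⟨n - 1, by omega⟩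
      exact SignedIndex.partialSum_nil m
    rw [coef, this, pow_succ', div_div]

theorem proper_replicate_p (k : ℕ) : proper (List.replicate k .o ++ [.p]) := by
  induction k with
  | zero => rfl
  | succ k ih =>
    rw [List.replicate_succ, List.cons_append, proper_cons]
    exact ⟨fun _ => by simp, ih⟩

theorem isPositive_replicate_p (k : ℕ) : isPositive (List.replicate k .o ++ [.p]) := by
  induction k with
  | zero => rfl
  | succ k ih => rw [List.replicate_succ, List.cons_append]; exact ih

theorem hasValue_polylogHalf (k : ℕ) :
    HasValue (subst halfSubst (List.replicate k .o ++ [.p])) (polylogHalf (k + 1)) := by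
  set w : Word := List.replicate k .o ++ [.p] with hw
  have hval : polylog w (1 / 2) = polylogHalf (k + 1) := by
    have hs : Summable fun n => coef w n * (1 / 2 : ℝ) ^ n :=
      (summable_norm_mul_pow (abs_coef_le_const w) (by rw [abs_of_pos] <;> norm_num)).of_norm
    rw [polylog, hs.tsum_eq_zero_add, polylogHalf]
    simp only [hw, coef_replicate_p]
    simp only [Nat.cast_zero, ne_eq, Nat.add_eq_zero_iff, one_ne_zero, and_false,
      not_false_eq_true, zero_pow, div_zero, zero_mul, zero_add]
    refine tsum_congr fun n => ?_
    push_cast; ring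
  have hc : ContinuousAt (polylog w) (1 / 2) :=
    (hasDerivAt_tsum_mul_pow (abs_coef_le_const w) (by rw [abs_of_pos] <;> norm_num)).continuousAt
  have hlim : Tendsto (fun v : ℝ => v / (1 + v)) (𝓝[<] 1) (𝓝 (1 / 2)) := by
    have : Tendsto (fun v : ℝ => v / (1 + v)) (𝓝 1) (𝓝 (1 / (1 + 1))) :=
      tendsto_id.div (tendsto_const_nhds.add tendsto_id) (by norm_num)
    rw [show (1 : ℝ) + 1 = 2 by norm_num] at this
    exact this.mono_left nhdsWithin_le_nhds
  rw [← hval]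
  exact HasValue.congr (hc.tendsto.comp hlim) fun v hv =>
    (value_halfSubst (proper_replicate_p k) (isPositive_replicate_p k) hv).symm

theorem hasValue_zeta (k : ℕ) :
    HasValue [(1, List.replicate (k + 1) .o ++ [.p])] (∑' n : ℕ, 1 / (n : ℝ) ^ (k + 2)) := by
  have h := hasValue_cons_o (List.replicate k .o ++ [.p])
  rw [← List.cons_append, ← List.replicate_succ] at h
  convert h using 3 with n
  rw [coef_replicate_p]

theorem hasValue_zetaVal (k : ℕ) :
    HasValue [(1, List.replicate (k + 1) .o ++ [.p])] (zetaVal (k + 2)) := by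
  have h : zetaVal (k + 2) = ∑' n : ℕ, 1 / (n : ℝ) ^ (k + 2) := by
    rw [zetaVal, zeta_nat_eq_tsum_of_gt_one (by omega)]
    have : ∑' n : ℕ, 1 / (n : ℂ) ^ (k + 2) = ((∑' n : ℕ, 1 / (n : ℝ) ^ (k + 2) : ℝ) : ℂ) := by
      push_cast; rfl
    rw [this, Complex.ofReal_re]
  rw [h]; exact hasValue_zeta k

/-- The substitution `t ↦ 4 t / (1 + t) ^ 2`. -/
def landenSubst : Letter → List (ℤ × Letter)
  | .o => [(1, .o), (-2, .m)]
  | .p => [(2, .p), (2, .m)]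
  | .m => []

theorem landen_mem_Ioo {v : ℝ} (hv : v ∈ Set.Ioo (0 : ℝ) 1) :
    4 * v / (1 + v) ^ 2 ∈ Set.Ioo (0 : ℝ) 1 := by
  have h3 : 0 < (1 + v) ^ 2 := by have := hv.1; positivity
  refine ⟨div_pos (by linarith [hv.1]) h3, ?_⟩
  rw [div_lt_one h3]
  nlinarith [mul_pos (sub_pos.mpr hv.2) (sub_pos.mpr hv.2)]

theorem hasDerivAt_landen {v : ℝ} (hv : 1 + v ≠ 0) :
    HasDerivAt (fun v : ℝ => 4 * v / (1 + v) ^ 2) (4 * (1 - v) / (1 + v) ^ 3) v := by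
  have h1 := ((hasDerivAt_id v).const_mul 4).fun_div (((hasDerivAt_id v).const_add 1).fun_pow 2)
    (pow_ne_zero 2 hv)
  refine h1.congr_deriv ?_
  simp only [id]; field_simp; push_cast; ring

/-- The map has `1 - X = ((1 - t) / (1 + t))^2`, so the logarithmic derivatives of `X` and `1 - X`
only have poles at 0, 1 and -1. -/
theorem value_landenSubst {w : Word} (hw : proper w) (hm : isPositive w) {v : ℝ}
    (hv : v ∈ Set.Ioo (0 : ℝ) 1) :
    value (subst landenSubst w) v = polylog w (4 * v / (1 + v) ^ 2) := by
  refine value_subst (g := fun v => 4 * v / (1 + v) ^ 2) (g' := fun v => 4 * (1 - v) / (1 + v) ^ 3)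
    ?_ (fun v hv => landen_mem_Ioo hv) ?_ ?_ ?_ hw (ne_m_of_isPositive hm) hv
  · intro v hv
    exact hasDerivAt_landen (by have := hv.1; intro h; linarith)
  · have h := (hasDerivAt_landen (v := 0) (by norm_num)).continuousAt.tendsto
    simp only [mul_zero, zero_div] at h
    exact h.mono_left nhdsWithin_le_nhds
  · simp [landenSubst]
  · intro x hx v hv
    have h1 := hv.1.ne'
    have h2 : 1 - v ≠ 0 := by have := hv.2; intro h; linarith
    have h3 : 1 + v ≠ 0 := by have := hv.1; intro h; linarith
    cases x with
    | o =>
      simp only [landenSubst, form, List.map_cons, List.map_nil, List.sum_cons, List.sum_nil]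
      push_cast; field_simp; ring
    | p =>
      simp only [landenSubst, form, List.map_cons, List.map_nil, List.sum_cons, List.sum_nil]
      rw [show 1 - 4 * v / (1 + v) ^ 2 = (1 - v) ^ 2 / (1 + v) ^ 2 by field_simp; ring]
      push_cast; field_simp; ring
    | m => exact absurd rfl hx

end WordComb

/-! ### The binomial weight as an integral. -/

/-- The weight `4 ^ n / (n * binom(2n, n))`. -/
noncomputable def binomWeight (n : ℕ) : ℝ := 4 ^ n / (n * ((2 * n).choose n : ℝ))

theorem binomWeight_one : binomWeight 1 = 2 := by
  simp [binomWeight]; norm_num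

theorem binomWeight_succ {n : ℕ} (hn : 1 ≤ n) :
    binomWeight (n + 1) = n / (n + 1 / 2) * binomWeight n := by
  have h := Nat.succ_mul_centralBinom_succ n
  have h' : ((n : ℝ) + 1) * (Nat.centralBinom (n + 1) : ℝ) =
      2 * (2 * n + 1) * (Nat.centralBinom n : ℝ) := by exact_mod_cast h
  have hn' : (0 : ℝ) < n := by exact_mod_cast hn
  have hc : (0 : ℝ) < Nat.centralBinom n := by exact_mod_cast Nat.centralBinom_pos n
  rw [binomWeight, binomWeight, ← Nat.centralBinom_eq_two_mul_choose,
    ← Nat.centralBinom_eq_two_mul_choose]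
  push_cast
  rw [h', pow_succ]; field_simp; ring

theorem binomWeight_nonneg (n : ℕ) : 0 ≤ binomWeight n := by
  rw [binomWeight]; positivity

/-- The left side is nonincreasing because `n (n + 1) ≤ (n + 1/2)^2`, and it equals 4 at `n = 1`. -/
theorem sq_binomWeight_le {n : ℕ} (hn : 1 ≤ n) : binomWeight n ^ 2 * n ≤ 4 := by
  induction n, hn using Nat.le_induction with
  | base => rw [binomWeight_one]; norm_num
  | succ n hn ih =>
    have hn' : (0 : ℝ) < n := by exact_mod_cast hn
    rw [binomWeight_succ hn]
    push_cast
    calc ((n : ℝ) / (n + 1 / 2) * binomWeight n) ^ 2 * (n + 1)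
        = (binomWeight n ^ 2 * n) * (n * (n + 1) / (n + 1 / 2) ^ 2) := by field_simp
      _ ≤ (binomWeight n ^ 2 * n) * 1 := by
          refine mul_le_mul_of_nonneg_left ?_ (by positivity)
          rw [div_le_one (by positivity)]; nlinarith
      _ ≤ 4 := by linarith

theorem binomWeight_le {n : ℕ} (hn : 1 ≤ n) : binomWeight n ≤ 2 * (n : ℝ) ^ (-(1 / 2) : ℝ) := by
  have hn' : (0 : ℝ) < n := by exact_mod_cast hn
  refine abs_le_of_sq_le_sq' ?_ (by positivity) |>.2
  rw [mul_pow, ← Real.rpow_natCast ((n : ℝ) ^ (-(1 / 2) : ℝ)), ← Real.rpow_mul hn'.le]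
  norm_num
  rw [Real.rpow_neg_one, ← div_eq_mul_inv, le_div_iff₀ hn']
  exact sq_binomWeight_le hn

/-- The primitive of `(4 t / (1 + t) ^ 2) ^ n / t` that vanishes at `0`, for `n ≥ 1`. -/
noncomputable def landenPrimitive : ℕ → ℝ → ℝ
  | 0, _ => 0
  | 1, v => 4 * v / (1 + v)
  | n + 2, v => ((n + 1) * landenPrimitive (n + 1) v -
      (4 * v / (1 + v) ^ 2) ^ (n + 1) * ((1 - v) / (1 + v))) / (n + 3 / 2)

/-- Integration by parts. With `y = (1 - v) / (1 + v)`, so that `y^2 = 1 - X`, one has `dX/X = y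
dv/v` and `dy = -X dv / (2v)`; hence `d(X^m y) = (m X^m - (m + 1/2) X^(m+1)) dv/v`. -/
theorem hasDerivAt_landenPrimitive (n : ℕ) {v : ℝ} (hv : 0 ≤ v) :
    HasDerivAt (landenPrimitive (n + 1))
      ((4 * v / (1 + v) ^ 2) ^ n * (4 / (1 + v) ^ 2)) v := by
  have h3 : 1 + v ≠ 0 := by intro h; linarith
  induction n with
  | zero =>
    have h := ((hasDerivAt_id v).const_mul 4).fun_div ((hasDerivAt_id v).const_add 1) h3
    refine h.congr_deriv ?_
    simp only [id]; field_simp; ring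
  | succ n ih =>
    have hy : HasDerivAt (fun v : ℝ => (1 - v) / (1 + v)) (-2 / (1 + v) ^ 2) v := by
      refine (((hasDerivAt_id v).const_sub 1).fun_div ((hasDerivAt_id v).const_add 1)
        h3).congr_deriv ?_
      simp only [id]; field_simp; ring
    have hX := (WordComb.hasDerivAt_landen h3).fun_pow (n + 1)
    have h := ((ih.const_mul ((n : ℝ) + 1)).fun_sub (hX.fun_mul hy)).div_const ((n : ℝ) + 3 / 2)
    refine h.congr_deriv ?_
    have h4 : (n : ℝ) + 3 / 2 ≠ 0 := by positivity
    simp only [Nat.add_sub_cancel, pow_succ]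
    push_cast
    -- With the common power as a free symbol, the identity is one of rational functions.
    generalize (4 * v / (1 * (1 + v) * (1 + v))) ^ n = Z
    field_simp
    ring

theorem landenPrimitive_zero (n : ℕ) : landenPrimitive n 0 = 0 := by
  match n with
  | 0 => rfl
  | 1 => simp [landenPrimitive]
  | n + 2 => simp [landenPrimitive, landenPrimitive_zero (n + 1)]

/-- The boundary term vanishes at 1, leaving the recurrence of `binomWeight`. -/
theorem landenPrimitive_one (n : ℕ) : landenPrimitive (n + 1) 1 = binomWeight (n + 1) := by
  induction n with
  | zero => rw [binomWeight_one]; simp [landenPrimitive]; norm_num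
  | succ n ih =>
    rw [landenPrimitive, ih, binomWeight_succ (n := n + 1) (by omega)]
    push_cast
    rw [sub_self, zero_div, mul_zero, sub_zero, show (n : ℝ) + 1 + 1 / 2 = n + 3 / 2 by ring]
    ring

theorem continuousAt_landenPrimitive (n : ℕ) {v : ℝ} (hv : 0 ≤ v) :
    ContinuousAt (landenPrimitive n) v := by
  rcases n with _ | n
  · exact continuousAt_const
  · exact (hasDerivAt_landenPrimitive n hv).continuousAt

theorem landenPrimitive_mem (n : ℕ) {v : ℝ} (hv : v ∈ Set.Ioo (0 : ℝ) 1) :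
    |landenPrimitive n v| ≤ binomWeight n := by
  rcases n with _ | n
  · simp [landenPrimitive, binomWeight]
  have hmono : MonotoneOn (landenPrimitive (n + 1)) (Set.Icc 0 1) := by
    refine monotoneOn_of_deriv_nonneg (convex_Icc 0 1) ?_ ?_ ?_
    · exact fun v hv => (continuousAt_landenPrimitive _ hv.1).continuousWithinAt
    · intro v hv
      rw [interior_Icc] at hv
      exact (hasDerivAt_landenPrimitive n hv.1.le).differentiableAt.differentiableWithinAt
    · intro v hv
      rw [interior_Icc] at hv
      rw [(hasDerivAt_landenPrimitive n hv.1.le).deriv]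
      have := hv.1
      positivity
  have h0 := hmono (Set.left_mem_Icc.mpr zero_le_one) ⟨hv.1.le, hv.2.le⟩ hv.1.le
  have h1 := hmono ⟨hv.1.le, hv.2.le⟩ (Set.right_mem_Icc.mpr zero_le_one) hv.2.le
  rw [landenPrimitive_zero] at h0
  rw [landenPrimitive_one] at h1
  rwa [abs_of_nonneg h0]

namespace WordComb

open Word

/-- The exponents add up to `3/4 + 1/2 = 5/4 > 1`. This series is also the dominating one for the
limits at 0 and 1. -/
theorem summable_coef_mul_binomWeight (w : Word) :
    Summable fun n => |coef w n| * binomWeight n := by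
  refine Summable.of_nonneg_of_le
    (fun n => mul_nonneg (abs_nonneg _) (binomWeight_nonneg n)) (fun n => ?_)
    ((summable_nat_rpow_neg (show (1 : ℝ) < 5 / 4 by norm_num)).mul_left (4 ^ w.length * 2))
  rcases Nat.eq_zero_or_pos n with rfl | hn
  · simp [binomWeight]
  have hn' : (0 : ℝ) < n := by exact_mod_cast hn
  calc _ ≤ 4 ^ w.length * (n : ℝ) ^ (-(3 / 4) : ℝ) * (2 * (n : ℝ) ^ (-(1 / 2) : ℝ)) :=
        mul_le_mul (abs_coef_le w n hn) (binomWeight_le hn) (binomWeight_nonneg n) (by positivity)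
    _ = _ := by
        rw [show (-(5 / 4) : ℝ) = -(3 / 4) + -(1 / 2) by norm_num, Real.rpow_add hn']; ring

/-- Termwise differentiation, with a geometric bound on a subinterval `(a, b)` where `X` stays below
`X(b) < 1`. The word must be nonempty so that no constant term produces `1/v`. -/
theorem hasDerivAt_tsum_landenPrimitive {w : Word} (hw : w ≠ []) {v : ℝ}
    (hv : v ∈ Set.Ioo (0 : ℝ) 1) :
    HasDerivAt (fun v => ∑' n, coef w n * landenPrimitive n v)
      (form .o v * polylog w (4 * v / (1 + v) ^ 2)) v := by
  obtain ⟨a, ha0, hav⟩ := exists_between hv.1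
  obtain ⟨b, hvb, hb1⟩ := exists_between hv.2
  have hb := landen_mem_Ioo (v := b) ⟨hv.1.trans hvb, hb1⟩
  have hu : Summable fun n : ℕ => 4 ^ w.length * ((4 * b / (1 + b) ^ 2) ^ n * (1 / a)) :=
    ((summable_geometric_of_lt_one hb.1.le hb.2).mul_right (1 / a)).mul_left _
  have h0 : coef w 0 = 0 := by
    rcases w with _ | ⟨x, w⟩
    · exact absurd rfl hw
    · exact coef_cons_zero x w
  have hS := summable_coef_mul_binomWeight w
  have h := hasDerivAt_tsum_of_isPreconnected hu isOpen_Ioo (isPreconnected_Ioo (a := a) (b := b))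
    (g := fun n v => coef w n * landenPrimitive n v)
    (g' := fun n v => coef w n * ((4 * v / (1 + v) ^ 2) ^ n * (1 / v))) (y₀ := v) (y := v)
    ?_ ?_ ⟨hav, hvb⟩ ?_ ⟨hav, hvb⟩
  · refine h.congr_deriv ?_
    rw [polylog, form, ← tsum_mul_left]
    exact tsum_congr fun n => by ring
  · intro n y hy
    have hy0 : 0 < y := ha0.trans hy.1
    rcases n with _ | n
    · simpa [h0] using hasDerivAt_const y (0 : ℝ)
    · refine ((hasDerivAt_landenPrimitive n hy0.le).const_mul (coef w (n + 1))).congr_deriv ?_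
      rw [pow_succ (4 * y / (1 + y) ^ 2) n]; field_simp
  · intro n y hy
    have hy0 : 0 < y := ha0.trans hy.1
    have hXy : 4 * y / (1 + y) ^ 2 ≤ 4 * b / (1 + b) ^ 2 := by
      have hb0 : 0 < b := hv.1.trans hvb
      rw [div_le_div_iff₀ (by positivity) (by positivity)]
      have : 0 ≤ (b - y) * (1 - y * b) :=
        mul_nonneg (by linarith [hy.2]) (by nlinarith [hy.2, mul_pos hy0 hb0])
      nlinarith
    have hX0 : 0 ≤ 4 * y / (1 + y) ^ 2 := by positivity
    rw [norm_mul, Real.norm_eq_abs, Real.norm_eq_abs,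
      abs_of_nonneg (show 0 ≤ (4 * y / (1 + y) ^ 2) ^ n * (1 / y) by positivity)]
    refine mul_le_mul (abs_coef_le_const w n) ?_ (by positivity) (by positivity)
    exact mul_le_mul (pow_le_pow_left₀ hX0 hXy n) (one_div_le_one_div_of_le ha0 hy.1.le)
      (by positivity) (pow_nonneg hb.1.le n)
  · refine Summable.of_norm_bounded hS fun n => ?_
    rw [norm_mul]
    exact mul_le_mul_of_nonneg_left (landenPrimitive_mem n hv) (abs_nonneg _)

/-- Both sides are primitives of `polylog w (X(v)) / v` with limit 0 at 0. Dominated convergence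
carries the series of primitives to `v = 1`, where the primitives become the binomial weights. -/
theorem hasValue_binomWeight {w : Word} (hw : w ≠ []) (hp : proper w) (hm : isPositive w) :
    HasValue (mapWord (.o :: ·) (subst landenSubst w)) (∑' n, coef w n * binomWeight n) := by
  have hS := summable_coef_mul_binomWeight w
  have hlim : ∀ a : ℝ, 0 ≤ a → ∀ s : Set ℝ, Set.Ioo 0 1 ∈ 𝓝[s] a →
      Tendsto (fun v => ∑' n, coef w n * landenPrimitive n v) (𝓝[s] a)
        (𝓝 (∑' n, coef w n * landenPrimitive n a)) := by
    intro a ha s hs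
    refine tendsto_tsum_of_dominated_convergence hS (fun n => ?_) ?_
    · exact ((continuousAt_landenPrimitive n ha).tendsto.mono_left nhdsWithin_le_nhds).const_mul _
    · filter_upwards [hs] with v hv n
      rw [norm_mul]
      exact mul_le_mul_of_nonneg_left (landenPrimitive_mem n hv) (abs_nonneg _)
  have h0 := hlim 0 le_rfl (Set.Ioi 0) (Ioo_mem_nhdsGT one_pos)
  have h1 := hlim 1 zero_le_one (Set.Iio 1) (Ioo_mem_nhdsLT one_pos)
  simp only [landenPrimitive_zero, mul_zero, tsum_zero] at h0
  have h1' : ∑' n, coef w n * landenPrimitive n 1 = ∑' n, coef w n * binomWeight n := by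
    refine tsum_congr fun n => ?_
    rcases n with _ | n
    · simp [landenPrimitive, binomWeight]
    · rw [landenPrimitive_one]
  rw [h1'] at h1
  have heq := eqOn_of_hasDerivAt (f := fun v => ∑' n, coef w n * landenPrimitive n v)
    (g := value (mapWord (.o :: ·) (subst landenSubst w)))
    (fun v hv => hasDerivAt_tsum_landenPrimitive hw hv)
    (fun v hv => by
      rw [← value_landenSubst hp hm hv]
      exact hasDerivAt_value_mapWord (fun t ht _ => ne_nil_of_mem_subst hw ht) hv)
    h0 (tendsto_value_zero fun t ht => by
      simp only [mapWord, List.mem_map] at ht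
      obtain ⟨q, -, rfl⟩ := ht
      simp)
  exact HasValue.congr h1 fun v hv => heq hv

end WordComb

/-! ### Products of harmonic numbers as nested sums. -/

namespace SignedIndex

/-- Multiplication of a sum of nested sums by `H_n^{(k)}`, where `n` is the largest variable. -/
def mulHarmonic (k : ℕ) (L : List SignedIndex) : List SignedIndex :=
  L.flatMap fun
    | [] => []
    | i :: l => (stuffle l [(k - 1, false)]).map (i :: ·) ++ [(i.1 + k, i.2) :: l]

/-- Nested sums use strict inequalities, so the term `j = n` is split off. In `mulHarmonic` that
term raises the leading exponent, and the strict part is quasi-shuffled into the inner sum. -/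
theorem genHarmonic_eq {k n : ℕ} (hk : 1 ≤ k) (hn : 1 ≤ n) :
    genHarmonic k n = partialSum [(k - 1, false)] n + 1 / (n : ℝ) ^ k := by
  have h1 : ∀ j : ℕ, term [(k - 1, false)] j = if j = 0 then 0 else 1 / (j : ℝ) ^ k := by
    intro j
    rcases j with _ | j
    · simp [term]
    · have h := partialSum_nil j
      rw [partialSum] at h
      rw [term, h, Nat.sub_add_cancel hk]
      simp [sign]
  obtain ⟨m, rfl⟩ : ∃ m, n = m + 1 := ⟨n - 1, by omega⟩
  have h0 : term [(k - 1, false)] 0 = 0 := by simp [h1]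
  rw [genHarmonic, partialSum, Finset.sum_range_succ', h0, add_zero,
    Finset.sum_Icc_succ_top (by omega)]
  congr 1
  rw [← Finset.Ico_add_one_right_eq_Icc, Finset.sum_Ico_eq_sum_range]
  refine Finset.sum_congr (by simp) fun j _ => ?_
  rw [h1, if_neg (by omega), add_comm 1 j]

theorem sum_term_mulHarmonic {k : ℕ} (hk : 1 ≤ k) (L : List SignedIndex) {n : ℕ} (hn : 1 ≤ n) :
    ((mulHarmonic k L).map fun t => term t n).sum =
      (L.map fun t => term t n).sum * genHarmonic k n := by
  induction L with
  | nil => simp [mulHarmonic]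
  | cons l L ih =>
    rw [mulHarmonic] at ih ⊢
    rw [List.flatMap_cons, List.map_append, List.sum_append, ih, List.map_cons, List.sum_cons,
      add_mul]
    congr 1
    rcases l with _ | ⟨i, l⟩
    · simp [term, Nat.one_le_iff_ne_zero.mp hn]
    · rw [List.map_append, List.sum_append, sum_map_term_cons, ← partialSum_mul_partialSum,
        genHarmonic_eq hk hn]
      have h : term (i :: l) n = (sign i.2 : ℝ) ^ n / (n : ℝ) ^ (i.1 + 1) * partialSum l n := rfl
      have h' : term ((i.1 + k, i.2) :: l) n =
        (sign i.2 : ℝ) ^ n / (n : ℝ) ^ (i.1 + k + 1) * partialSum l n := rfl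
      have hn' : (n : ℝ) ≠ 0 := by positivity
      rw [List.map_singleton, List.sum_singleton, h, h', show i.1 + k + 1 = i.1 + 1 + k by ring,
        pow_add _ (i.1 + 1) k]
      field_simp

/-- The expansion of `n ^ (1 - p) * ∏ H_n^{(a)}` into nested sums. -/
def ofHarmonics (a : List ℕ) (p : ℕ) : List SignedIndex :=
  -- One factor `1/n` sits in `binomWeight`, and an entry `k` encodes exponent `k + 1`; hence `p -
  -- 2`.
  a.foldr mulHarmonic [[(p - 2, false)]]

theorem sum_term_ofHarmonics {a : List ℕ} (ha : ∀ k ∈ a, 1 ≤ k) {p : ℕ} (hp : 2 ≤ p) {n : ℕ}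
    (hn : 1 ≤ n) :
    ((ofHarmonics a p).map fun t => term t n).sum =
      1 / (n : ℝ) ^ (p - 1) * (a.map fun k => genHarmonic k n).prod := by
  induction a with
  | nil =>
    obtain ⟨m, rfl⟩ : ∃ m, n = m + 1 := ⟨n - 1, by omega⟩
    have h := partialSum_nil m
    rw [partialSum] at h
    rw [ofHarmonics, List.foldr_nil, List.map_singleton, List.sum_singleton, term, h,
      show p - 2 + 1 = p - 1 by omega]
    simp [sign]
  | cons k a ih =>
    rw [ofHarmonics, List.foldr_cons] at *
    rw [sum_term_mulHarmonic (ha k (by simp)) _ hn, ih fun j hj => ha j (by simp [hj]),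
      List.map_cons, List.prod_cons]
    ring

end SignedIndex

namespace WordComb

open Word SignedIndex

/-- The combination of words representing an inverse binomial Euler sum. -/
def ofIBES (a : List ℕ) (p : ℕ) : WordComb :=
  (ofHarmonics a p).flatMap fun t =>
    smul (wordSign false t) (mapWord (.o :: ·) (subst landenSubst (toWord false t)))

theorem hasValue_sum_binomWeight (L : List SignedIndex)
    (hL : ∀ t ∈ L, t ≠ [] ∧ isPositive (toWord false t)) :
    (Summable fun n => binomWeight n * (L.map fun t => term t n).sum) ∧
    HasValue (L.flatMap fun t =>
      smul (wordSign false t) (mapWord (.o :: ·) (subst landenSubst (toWord false t))))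
      (∑' n, binomWeight n * (L.map fun t => term t n).sum) := by
  induction L with
  | nil => simpa using hasValue_nil
  | cons l L ih =>
    obtain ⟨ih1, ih2⟩ := ih fun t ht => hL t (by simp [ht])
    obtain ⟨h1, h2⟩ := hL l (by simp)
    have hne : toWord false l ≠ [] := by
      rcases l with _ | ⟨⟨k, e⟩, l⟩
      · exact absurd rfl h1
      · simp [toWord]
    have ht : ∀ n, wordSign false l * (coef (toWord false l) n * binomWeight n) =
        binomWeight n * term l n := by
      intro n
      have h := coef_toWord false l n
      simp only [sign, Bool.false_eq_true, if_false, Int.cast_one, one_pow, one_mul] at h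
      rw [← h]; ring
    have hs : Summable fun n => binomWeight n * term l n := by
      refine (((summable_coef_mul_binomWeight (toWord false l)).of_norm_bounded
        fun n => ?_).mul_left (wordSign false l : ℝ)).congr ht
      rw [norm_mul, Real.norm_eq_abs, Real.norm_eq_abs, abs_of_nonneg (binomWeight_nonneg n)]
    have hv := (hasValue_binomWeight hne (proper_toWord false l) h2).smul (wordSign false l)
    rw [← tsum_mul_left, tsum_congr ht] at hv
    have hsum : ∀ n, binomWeight n * term l n + binomWeight n * (L.map fun t => term t n).sum =
        binomWeight n * ((l :: L).map fun t => term t n).sum := by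
      intro n; rw [List.map_cons, List.sum_cons, mul_add]
    refine ⟨(hs.add ih1).congr hsum, ?_⟩
    rw [← tsum_congr hsum, hs.tsum_add ih1]
    exact hv.append ih2

theorem ibesTerm_eq {a : List ℕ} (ha : ∀ k ∈ a, 1 ≤ k) {p : ℕ} (hp : 2 ≤ p) {n : ℕ}
    (hn : 1 ≤ n) :
    ibesTerm a p n = binomWeight n * ((ofHarmonics a p).map fun t => term t n).sum := by
  have hn' : (n : ℝ) ≠ 0 := by positivity
  obtain ⟨q, rfl⟩ : ∃ q, p = q + 1 := ⟨p - 1, by omega⟩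
  rw [sum_term_ofHarmonics ha hp hn, ibesTerm, binomWeight, Multiset.map_coe, Multiset.prod_coe,
    Nat.add_sub_cancel, pow_succ]
  have hc : ((2 * n).choose n : ℝ) ≠ 0 := by
    rw [← Nat.centralBinom_eq_two_mul_choose]
    exact_mod_cast Nat.centralBinom_ne_zero n
  field_simp

theorem hasValue_ofIBES {a : List ℕ} (ha : ∀ k ∈ a, 1 ≤ k) {p : ℕ} (hp : 2 ≤ p)
    (h : ∀ t ∈ ofHarmonics a p, t ≠ [] ∧ isPositive (toWord false t)) :
    (Summable fun n : ℕ => ibesTerm a p (n + 1)) ∧ HasValue (ofIBES a p) (IBES a p) := by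
  obtain ⟨h1, h2⟩ := hasValue_sum_binomWeight _ h
  have heq : ∀ n : ℕ, ibesTerm a p (n + 1) =
      binomWeight (n + 1) * ((ofHarmonics a p).map fun t => term t (n + 1)).sum :=
    fun n => ibesTerm_eq ha hp (by omega)
  rw [h1.tsum_eq_zero_add] at h2
  simp only [← heq] at h2
  -- Division by zero kills the term at 0, so summing from 0 or from 1 agrees.
  have h0 : binomWeight 0 = 0 := by simp [binomWeight]
  rw [h0, zero_mul, zero_add] at h2
  exact ⟨((summable_nat_add_iff 1).mpr h1).congr fun n => (heq n).symm, h2⟩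

/-! ### Formal relations and the certificate checker. -/

/-- Relations between the values of words. -/
inductive Relation
  | stuffle (u w : SignedIndex)
  | square (w : Word)
  | mul (r : Relation) (w : Word)

namespace Relation

/-- The combination asserted to have value `0`. -/
def toComb : Relation → WordComb
  | stuffle u w => stuffleRel u w
  | square w => squareRel w
  | mul r w => WordComb.mul (toComb r) [(1, w)]

/-- A sufficient condition for a word to have a value. -/
def isFinite : Word → Bool
  | .o :: _ => true
  | [.m] => true
  | _ => false

/-- A sufficient condition for the relation to hold. -/
def isValid : Relation → Bool
  | stuffle (_ :: _) ((_ + 1, _) :: _) => true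
  | square (.o :: w) => proper (.o :: w) && isPositive w
  | mul r w => isValid r && isProper (toComb r) && isFinite w && proper w
  | _ => false

theorem exists_hasValue {w : Word} (hw : isFinite w) : ∃ x, HasValue [(1, w)] x := by
  match w with
  | .o :: w => exact ⟨_, hasValue_cons_o w⟩
  | [.m] => exact ⟨_, hasValue_log_two⟩
  | [] => simp [isFinite] at hw
  | .p :: _ => simp [isFinite] at hw
  | .m :: _ :: _ => simp [isFinite] at hw

/-- For products, the relation tends to 0 as a function and the extra word has a finite limit, so
the shuffle product tends to 0. -/
theorem hasValue_toComb {r : Relation} (hr : isValid r) : HasValue (toComb r) 0 := by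
  match r with
  | stuffle (i :: u) ((k + 1, e) :: w) => exact hasValue_stuffleRel (by simp) k e w
  | stuffle (i :: u) ((0, e) :: w) => simp [isValid] at hr
  | stuffle (i :: u) [] => simp [isValid] at hr
  | stuffle [] _ => simp [isValid] at hr
  | square (.o :: w) =>
    simp only [isValid, Bool.and_eq_true] at hr
    exact hasValue_squareRel hr.1 hr.2
  | square [] => simp [isValid] at hr
  | square (.p :: w) => simp [isValid] at hr
  | square (.m :: w) => simp [isValid] at hr
  | mul r w =>
    simp only [isValid, Bool.and_eq_true] at hr
    obtain ⟨x, hx⟩ := exists_hasValue hr.1.2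
    have h := (hasValue_toComb hr.1.1.1).mul hx hr.1.1.2 (by simp [isProper, hr.2])
    rwa [zero_mul] at h

end Relation

/-- Ternary tries with integer labels, as normal forms of combinations of words. -/
inductive Trie
  | nil
  | node (c : ℤ) (o p m : Trie)

namespace Trie

/-- Add `c` at the word. -/
def insert (c : ℤ) : Word → Trie → Trie
  | [], nil => node c nil nil nil
  | [], node d o p m => node (c + d) o p m
  | .o :: w, nil => node 0 (insert c w nil) nil nil
  | .o :: w, node d o p m => node d (insert c w o) p m
  | .p :: w, nil => node 0 nil (insert c w nil) nil
  | .p :: w, node d o p m => node d o (insert c w p) m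
  | .m :: w, nil => node 0 nil nil (insert c w nil)
  | .m :: w, node d o p m => node d o p (insert c w m)

/-- All labels vanish. -/
def isZero : Trie → Bool
  | nil => true
  | node c o p m => decide (c = 0) && isZero o && isZero p && isZero m

/-- The linear extension of a function of words. -/
def eval : Trie → (Word → ℝ) → ℝ
  | nil, _ => 0
  | node c o p m, f => c * f [] + eval o (fun w => f (.o :: w)) + eval p (fun w => f (.p :: w)) +
      eval m (fun w => f (.m :: w))

theorem eval_insert (c : ℤ) (w : Word) (t : Trie) (f : Word → ℝ) :
    eval (insert c w t) f = c * f w + eval t f := by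
  induction w generalizing t f with
  | nil => cases t <;> simp [insert, eval]; ring
  | cons x w ih => cases x <;> cases t <;> simp [insert, eval, ih] <;> ring

theorem eval_of_isZero {t : Trie} (ht : isZero t) (f : Word → ℝ) : eval t f = 0 := by
  induction t generalizing f with
  | nil => rfl
  | node c o p m iho ihp ihm =>
    simp only [isZero, Bool.and_eq_true, decide_eq_true_eq] at ht
    simp [eval, ht.1.1.1, iho ht.1.1.2, ihp ht.1.2, ihm ht.2]

end Trie

/-- The normal form of a combination. -/
def toTrie (r : WordComb) : Trie := r.foldr (fun t s => Trie.insert t.1 t.2 s) .nil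

theorem eval_toTrie (r : WordComb) (f : Word → ℝ) : (toTrie r).eval f = eval f r := by
  induction r with
  | nil => rfl
  | cons t r ih => rw [toTrie, List.foldr_cons, Trie.eval_insert, eval_cons, ← ih]; rfl

/-- Integral linear combinations of combinations of words. -/
def linComb : List ℤ → List WordComb → WordComb
  | c :: cs, r :: rs => smul c r ++ linComb cs rs
  | _, _ => []

/-- Integral linear combinations of real numbers. -/
noncomputable def dot : List ℤ → List ℝ → ℝ
  | c :: cs, x :: xs => c * x + dot cs xs
  | _, _ => 0

theorem hasValue_linComb {rs : List WordComb} {xs : List ℝ} (h : List.Forall₂ HasValue rs xs)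
    (cs : List ℤ) : HasValue (linComb cs rs) (dot cs xs) := by
  induction h generalizing cs with
  | nil => cases cs <;> exact hasValue_nil
  | cons hr _ ih =>
    cases cs with
    | nil => exact hasValue_nil
    | cons c cs => exact (hr.smul c).append (ih cs)

theorem hasValue_linComb_relations {rels : List Relation} (h : rels.all Relation.isValid)
    (cs : List ℤ) : HasValue (linComb cs (rels.map Relation.toComb)) 0 := by
  induction rels generalizing cs with
  | nil => cases cs <;> exact hasValue_nil
  | cons r rels ih =>
    cases cs with
    | nil => exact hasValue_nil
    | cons c cs =>
      simp only [List.all_cons, Bool.and_eq_true] at h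
      have := ((Relation.hasValue_toComb h.1).smul c).append (ih h.2 cs)
      rwa [mul_zero, zero_add] at this

theorem dot_mem_span {s : Set ℝ} {xs : List ℝ} (h : ∀ x ∈ xs, x ∈ Submodule.span ℚ s)
    (cs : List ℤ) : dot cs xs ∈ Submodule.span ℚ s := by
  induction xs generalizing cs with
  | nil => cases cs <;> exact zero_mem _
  | cons x xs ih =>
    cases cs with
    | nil => exact zero_mem _
    | cons c cs =>
      refine add_mem ?_ (ih (fun y hy => h y (by simp [hy])) cs)
      have := Submodule.smul_mem _ (c : ℚ) (h x (by simp))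
      rwa [Rat.smul_def, Rat.cast_intCast] at this

/-- The check that `d * r` is a combination of the basis and of the relations. -/
def certifies (r : WordComb) (d : ℤ) (bs : List WordComb) (cs : List ℤ) (rels : List Relation)
    (es : List ℤ) : Bool :=
  (toTrie (smul d r ++ (linComb cs bs ++ linComb es (rels.map Relation.toComb)))).isZero

/-- The certificate yields `d * x + dot cs xs = 0`, with the relations contributing 0; dividing by
`d` is where rational coefficients enter. -/
theorem mem_span_of_certifies {r : WordComb} {x : ℝ} (hr : HasValue r x) {d : ℤ} (hd : d ≠ 0)
    {bs : List WordComb} {xs : List ℝ} (hb : List.Forall₂ HasValue bs xs) {s : Set ℝ}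
    (hs : ∀ y ∈ xs, y ∈ Submodule.span ℚ s) {cs : List ℤ} {rels : List Relation}
    (hrels : rels.all Relation.isValid) {es : List ℤ}
    (h : certifies r d bs cs rels es) : x ∈ Submodule.span ℚ s := by
  have h1 := (hr.smul d).append
    ((hasValue_linComb hb cs).append (hasValue_linComb_relations hrels es))
  -- All words cancel formally, so the function is identically zero even if some of them diverge at
  -- 1.
  have h2 : value (smul d r ++ (linComb cs bs ++ linComb es (rels.map Relation.toComb))) =
      fun _ => 0 := by
    funext v
    rw [value, ← eval_toTrie]
    exact Trie.eval_of_isZero h _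
  rw [HasValue, h2] at h1
  have h3 := tendsto_nhds_unique h1 tendsto_const_nhds
  rw [add_zero] at h3
  have hd' : (d : ℝ) ≠ 0 := by exact_mod_cast hd
  have h4 : x = ((-(1 / d : ℚ) : ℚ) : ℝ) * dot cs xs := by
    push_cast; field_simp; linarith
  rw [h4, ← Rat.smul_def]
  exact Submodule.smul_mem _ _ (dot_mem_span hs cs)

end WordComb

/-! ### Basis constants and the relations used in each weight. -/

namespace WordComb

open Word SignedIndex

/-- The word of `ζ(k + 1)`. -/
def zetaWord (k : ℕ) : Word := List.replicate k .o ++ [.p]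

/-- The combination with value `log 2`. -/
def logComb : WordComb := [(1, [.m])]

/-- The combination with value `ζ(s)`, for `s ≥ 2`. -/
def zetaComb (s : ℕ) : WordComb := [(1, zetaWord (s - 1))]

/-- The combination with value `Li_s(1/2)`, for `s ≥ 1`. -/
def halfComb (s : ℕ) : WordComb := subst halfSubst (zetaWord (s - 1))

theorem isProper_logComb : isProper logComb := rfl

theorem hasValue_logComb : HasValue logComb (Real.log 2) := hasValue_log_two

theorem hasValue_zetaComb_two : HasValue (zetaComb 2) (Real.pi ^ 2 / 6) := by
  have h := hasValue_zeta 0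
  rwa [hasSum_zeta_two.tsum_eq] at h

theorem hasValue_zetaComb_four : HasValue (zetaComb 4) (Real.pi ^ 4 / 90) := by
  have h := hasValue_zeta 2
  rwa [hasSum_zeta_four.tsum_eq] at h

theorem hasValue_zetaComb_three : HasValue (zetaComb 3) (zetaVal 3) := hasValue_zetaVal 1

theorem hasValue_zetaComb_five : HasValue (zetaComb 5) (zetaVal 5) := hasValue_zetaVal 3

theorem hasValue_halfComb_four : HasValue (halfComb 4) (polylogHalf 4) := hasValue_polylogHalf 3

theorem hasValue_halfComb_five : HasValue (halfComb 5) (polylogHalf 5) := hasValue_polylogHalf 4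

theorem HasValue.mul_log {r : WordComb} {x : ℝ} (hr : HasValue r x) (hr' : isProper r) :
    HasValue (WordComb.mul r logComb) (x * Real.log 2) :=
  hr.mul hasValue_logComb hr' isProper_logComb

theorem rat_mul_mem_span {s : Set ℝ} (q : ℚ) {x y : ℝ} (hx : x ∈ s) (h : y = q * x) :
    y ∈ Submodule.span ℚ s := by
  rw [h, ← Rat.smul_def]
  exact Submodule.smul_mem _ _ (Submodule.subset_span hx)

/-- An inverse binomial Euler sum converges, and lies in the span of `s` if a certificate exists. -/
theorem summable_and_mem_span {a : List ℕ} {p : ℕ} {d : ℤ} {cs es : List ℤ}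
    {bs : List WordComb} {xs : List ℝ} (hb : List.Forall₂ HasValue bs xs) {s : Set ℝ}
    (hs : ∀ y ∈ xs, y ∈ Submodule.span ℚ s) {rels : List Relation}
    (hrels : rels.all Relation.isValid) (ha : (∀ k ∈ a, 1 ≤ k) ∧ 2 ≤ p)
    (hpos : ∀ t ∈ ofHarmonics a p, t ≠ [] ∧ isPositive (toWord false t)) (hd : d ≠ 0)
    (h : certifies (ofIBES a p) d bs cs rels es) :
    (Summable fun n : ℕ => ibesTerm a p (n + 1)) ∧ IBES a p ∈ Submodule.span ℚ s := by
  obtain ⟨h1, h2⟩ := hasValue_ofIBES ha.1 ha.2 hpos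
  exact ⟨h1, mem_span_of_certifies h2 hd hb hs hrels h⟩

/-- Relations of weight 2. -/
def relationsTwo : List Relation :=
  [.square [.o, .p]]

/-- Relations of weight 3. -/
def relationsThree : List Relation :=
  [.mul (.square [.o, .p]) [.m],
    .stuffle [(0, true)] [(1, true)],
    .stuffle [(0, false)] [(1, true)],
    .stuffle [(0, false)] [(1, false)],
    .square [.o, .o, .p]]

/-- Relations of weight 4. -/
def relationsFour : List Relation :=
  [.square [.o, .o, .o, .p],
    .stuffle [(1, false)] [(1, false)],
    .stuffle [(0, false)] [(2, false)],
    .stuffle [(0, true), (0, true)] [(1, true)],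
    .square [.o, .o, .p, .p],
    .square [.o, .p, .o, .p],
    .stuffle [(0, true)] [(2, false)],
    .stuffle [(0, false)] [(1, false), (0, false)],
    .stuffle [(1, true)] [(1, true)],
    .stuffle [(0, false)] [(1, false), (0, true)],
    .stuffle [(0, false)] [(1, true), (0, true)],
    .stuffle [(0, false)] [(2, true)],
    .stuffle [(0, true), (0, true)] [(1, false)],
    .stuffle [(0, false)] [(1, true), (0, false)],
    .stuffle [(0, true)] [(1, true), (0, false)],
    .square [.o, .p, .p, .p],
    .stuffle [(0, true), (0, false)] [(1, false)],
    .stuffle [(0, true)] [(1, false), (0, false)],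
    .mul (.stuffle [(0, false)] [(1, false)]) [.m],
    .mul (.mul (.square [.o, .p]) [.m]) [.m]]

/-- Relations of weight 5. -/
def relationsFive : List Relation :=
  [.stuffle [(1, false)] [(2, false)],
    .square [.o, .o, .o, .o, .p],
    .square [.o, .o, .o, .p, .p],
    .stuffle [(0, false)] [(3, false)],
    .square [.o, .o, .p, .o, .p],
    .stuffle [(0, false)] [(1, false), (0, false), (0, false)],
    .stuffle [(1, true)] [(2, false)],
    .stuffle [(1, true), (0, true)] [(1, true)],
    .stuffle [(1, false), (0, false)] [(1, false)],
    .stuffle [(0, false)] [(2, false), (0, false)],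
    .stuffle [(0, false)] [(1, false), (1, false)],
    .stuffle [(0, false)] [(1, false), (1, true)],
    .square [.o, .p, .o, .o, .p],
    .stuffle [(1, false)] [(2, true)],
    .stuffle [(0, false)] [(2, false), (0, true)],
    .stuffle [(0, true)] [(3, true)],
    .stuffle [(1, false), (0, true)] [(1, false)],
    .stuffle [(0, true)] [(3, false)],
    .stuffle [(0, false)] [(1, false), (0, true), (0, true)],
    .stuffle [(0, false)] [(1, true), (1, true)],
    .stuffle [(0, false)] [(1, false), (0, false), (0, true)],
    .stuffle [(0, false)] [(2, true), (0, true)],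
    .stuffle [(0, true)] [(1, true), (1, true)],
    .stuffle [(0, false)] [(1, true), (0, false), (0, true)],
    .stuffle [(0, true)] [(2, true), (0, true)],
    .stuffle [(0, true)] [(1, false), (0, true), (0, true)],
    .stuffle [(1, true), (0, false)] [(1, true)],
    .stuffle [(1, true), (0, true)] [(1, false)],
    .stuffle [(0, true)] [(1, true), (0, false), (0, true)],
    .stuffle [(0, true), (1, true)] [(1, false)],
    .stuffle [(0, true), (0, true)] [(2, true)],
    .stuffle [(0, false)] [(1, true), (0, true), (0, false)],
    .stuffle [(0, true), (0, true)] [(2, false)],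
    .stuffle [(0, true)] [(1, true), (1, false)],
    .stuffle [(0, false)] [(1, true), (0, false), (0, false)],
    .square [.o, .p, .p, .o, .p],
    .stuffle [(0, false)] [(1, true), (1, false)],
    .stuffle [(0, false)] [(2, true), (0, false)],
    .mul (.square [.o, .o, .p]) [.o, .p],
    .stuffle [(0, false)] [(1, false), (0, true), (0, false)],
    .stuffle [(0, true)] [(2, false), (0, false)],
    .stuffle [(0, false)] [(1, true), (0, true), (0, true)],
    .stuffle [(0, true)] [(1, true), (0, false), (0, false)],
    .mul (.square [.o, .o, .o, .p]) [.m],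
    .stuffle [(0, true)] [(2, false), (0, true)],
    .stuffle [(0, true)] [(1, true), (0, true), (0, true)],
    .square [.o, .o, .p, .p, .p],
    .square [.o, .p, .o, .p, .p],
    .stuffle [(0, true), (0, false), (0, true)] [(1, true)],
    .stuffle [(0, true)] [(1, false), (0, false), (0, true)],
    .mul (.square [.o, .p]) [.o, .o, .m],
    .stuffle [(0, true)] [(1, true), (0, true), (0, false)],
    .stuffle [(0, true)] [(1, false), (1, false)],
    .stuffle [(0, true), (1, true)] [(1, true)],
    .stuffle [(1, true)] [(1, false), (0, false)],
    .stuffle [(0, true), (0, false), (0, true)] [(1, false)],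
    .stuffle [(1, true)] [(1, false), (0, true)],
    .stuffle [(0, true), (0, true)] [(1, true), (0, true)],
    .mul (.square [.o, .p]) [.o, .m, .p],
    .stuffle [(0, true)] [(1, false), (0, true), (0, false)],
    .stuffle [(0, true)] [(1, false), (0, false), (0, false)],
    .mul (.stuffle [(0, true), (0, true)] [(1, true)]) [.m],
    .stuffle [(0, true), (0, false), (0, false)] [(1, true)],
    .stuffle [(0, true), (0, false)] [(2, true)],
    .stuffle [(0, true), (0, true)] [(1, true), (0, false)],
    .stuffle [(0, true), (0, false)] [(1, true), (0, false)],
    .stuffle [(0, true), (0, true)] [(1, false), (0, false)],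
    .mul (.stuffle [(0, false)] [(1, false), (0, false)]) [.m],
    .mul (.mul (.mul (.square [.o, .p]) [.m]) [.m]) [.m],
    .mul (.stuffle [(0, false)] [(1, true), (0, true)]) [.m],
    .mul (.mul (.stuffle [(0, false)] [(1, true)]) [.m]) [.m]]

theorem relationsTwo_isValid : relationsTwo.all Relation.isValid := by decide +kernel

theorem relationsThree_isValid : relationsThree.all Relation.isValid := by decide +kernel

theorem relationsFour_isValid : relationsFour.all Relation.isValid := by decide +kernel

theorem relationsFive_isValid : relationsFive.all Relation.isValid := by decide +kernel

/-- Combinations whose values span the rational span of `fibBasis 2`. -/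
def basisTwo : List WordComb := [zetaComb 2, mul logComb logComb]

/-- Combinations whose values span the rational span of `fibBasis 3`. -/
def basisThree : List WordComb :=
  [mul (zetaComb 2) logComb, mul (mul logComb logComb) logComb, zetaComb 3]

/-- Combinations whose values span the rational span of `fibBasis 4`. -/
def basisFour : List WordComb :=
  [zetaComb 4, mul (mul (zetaComb 2) logComb) logComb,
    mul (mul (mul logComb logComb) logComb) logComb, mul (zetaComb 3) logComb, halfComb 4]

/-- Combinations whose values span the rational span of `fibBasis 5`. -/
def basisFive : List WordComb :=
  [mul (zetaComb 4) logComb, mul (mul (mul (zetaComb 2) logComb) logComb) logComb,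
    mul (mul (mul (mul logComb logComb) logComb) logComb) logComb,
    mul (zetaComb 2) (zetaComb 3), mul (mul (zetaComb 3) logComb) logComb, zetaComb 5,
    mul (halfComb 4) logComb, halfComb 5]

theorem hasValue_basisTwo :
    List.Forall₂ HasValue basisTwo [Real.pi ^ 2 / 6, Real.log 2 * Real.log 2] :=
  .cons hasValue_zetaComb_two <| .cons (hasValue_logComb.mul_log rfl) .nil

theorem hasValue_basisThree :
    List.Forall₂ HasValue basisThree [Real.pi ^ 2 / 6 * Real.log 2,
      Real.log 2 * Real.log 2 * Real.log 2, zetaVal 3] :=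
  .cons (hasValue_zetaComb_two.mul_log rfl) <|
  .cons ((hasValue_logComb.mul_log rfl).mul_log rfl) <|
  .cons hasValue_zetaComb_three .nil

theorem hasValue_basisFour :
    List.Forall₂ HasValue basisFour [Real.pi ^ 4 / 90, Real.pi ^ 2 / 6 * Real.log 2 * Real.log 2,
      Real.log 2 * Real.log 2 * Real.log 2 * Real.log 2, zetaVal 3 * Real.log 2, polylogHalf 4] :=
  .cons hasValue_zetaComb_four <|
  .cons ((hasValue_zetaComb_two.mul_log rfl).mul_log rfl) <|
  .cons (((hasValue_logComb.mul_log rfl).mul_log rfl).mul_log rfl) <|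
  .cons (hasValue_zetaComb_three.mul_log rfl) <|
  .cons hasValue_halfComb_four .nil

theorem hasValue_basisFive :
    List.Forall₂ HasValue basisFive [Real.pi ^ 4 / 90 * Real.log 2,
      Real.pi ^ 2 / 6 * Real.log 2 * Real.log 2 * Real.log 2,
      Real.log 2 * Real.log 2 * Real.log 2 * Real.log 2 * Real.log 2,
      Real.pi ^ 2 / 6 * zetaVal 3, zetaVal 3 * Real.log 2 * Real.log 2, zetaVal 5,
      polylogHalf 4 * Real.log 2, polylogHalf 5] :=
  .cons (hasValue_zetaComb_four.mul_log rfl) <|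
  .cons (((hasValue_zetaComb_two.mul_log rfl).mul_log rfl).mul_log rfl) <|
  .cons ((((hasValue_logComb.mul_log rfl).mul_log rfl).mul_log rfl).mul_log rfl) <|
  .cons (hasValue_zetaComb_two.mul hasValue_zetaComb_three rfl rfl) <|
  .cons ((hasValue_zetaComb_three.mul_log rfl).mul_log rfl) <|
  .cons hasValue_zetaComb_five <|
  .cons (hasValue_halfComb_four.mul_log rfl) <|
  .cons hasValue_halfComb_five .nil

theorem mem_span_fibBasis_two :
    ∀ y ∈ [Real.pi ^ 2 / 6, Real.log 2 * Real.log 2], y ∈ Submodule.span ℚ (fibBasis 2) := by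
  simp only [List.forall_mem_cons, List.not_mem_nil, false_imp_iff, implies_true, and_true]
  refine ⟨rat_mul_mem_span (1 / 6) (x := Real.pi ^ 2) (by simp [fibBasis]) ?_,
    rat_mul_mem_span 1 (x := Real.log 2 ^ 2) (by simp [fibBasis]) ?_⟩ <;> push_cast <;> ring

theorem mem_span_fibBasis_three :
    ∀ y ∈ [Real.pi ^ 2 / 6 * Real.log 2, Real.log 2 * Real.log 2 * Real.log 2, zetaVal 3],
      y ∈ Submodule.span ℚ (fibBasis 3) := by
  simp only [List.forall_mem_cons, List.not_mem_nil, false_imp_iff, implies_true, and_true]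
  refine ⟨rat_mul_mem_span (1 / 6) (x := Real.pi ^ 2 * Real.log 2) (by simp [fibBasis]) ?_,
    rat_mul_mem_span 1 (x := Real.log 2 ^ 3) (by simp [fibBasis]) ?_,
    rat_mul_mem_span 1 (x := zetaVal 3) (by simp [fibBasis]) ?_⟩ <;> push_cast <;> ring

theorem mem_span_fibBasis_four :
    ∀ y ∈ [Real.pi ^ 4 / 90, Real.pi ^ 2 / 6 * Real.log 2 * Real.log 2,
      Real.log 2 * Real.log 2 * Real.log 2 * Real.log 2, zetaVal 3 * Real.log 2, polylogHalf 4],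
      y ∈ Submodule.span ℚ (fibBasis 4) := by
  simp only [List.forall_mem_cons, List.not_mem_nil, false_imp_iff, implies_true, and_true]
  refine ⟨rat_mul_mem_span (1 / 90) (x := Real.pi ^ 4) (by simp [fibBasis]) ?_,
    rat_mul_mem_span (1 / 6) (x := Real.pi ^ 2 * Real.log 2 ^ 2) (by simp [fibBasis]) ?_,
    rat_mul_mem_span 1 (x := Real.log 2 ^ 4) (by simp [fibBasis]) ?_,
    rat_mul_mem_span 1 (x := zetaVal 3 * Real.log 2) (by simp [fibBasis]) ?_,
    rat_mul_mem_span 1 (x := polylogHalf 4) (by simp [fibBasis]) ?_⟩ <;> push_cast <;> ring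

theorem mem_span_fibBasis_five :
    ∀ y ∈ [Real.pi ^ 4 / 90 * Real.log 2,
      Real.pi ^ 2 / 6 * Real.log 2 * Real.log 2 * Real.log 2,
      Real.log 2 * Real.log 2 * Real.log 2 * Real.log 2 * Real.log 2,
      Real.pi ^ 2 / 6 * zetaVal 3, zetaVal 3 * Real.log 2 * Real.log 2, zetaVal 5,
      polylogHalf 4 * Real.log 2, polylogHalf 5], y ∈ Submodule.span ℚ (fibBasis 5) := by
  simp only [List.forall_mem_cons, List.not_mem_nil, false_imp_iff, implies_true, and_true]
  refine ⟨rat_mul_mem_span (1 / 90) (x := Real.pi ^ 4 * Real.log 2) (by simp [fibBasis]) ?_,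
    rat_mul_mem_span (1 / 6) (x := Real.pi ^ 2 * Real.log 2 ^ 3) (by simp [fibBasis]) ?_,
    rat_mul_mem_span 1 (x := Real.log 2 ^ 5) (by simp [fibBasis]) ?_,
    rat_mul_mem_span (1 / 6) (x := Real.pi ^ 2 * zetaVal 3) (by simp [fibBasis]) ?_,
    rat_mul_mem_span 1 (x := zetaVal 3 * Real.log 2 ^ 2) (by simp [fibBasis]) ?_,
    rat_mul_mem_span 1 (x := zetaVal 5) (by simp [fibBasis]) ?_,
    rat_mul_mem_span 1 (x := polylogHalf 4 * Real.log 2) (by simp [fibBasis]) ?_,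
    rat_mul_mem_span 1 (x := polylogHalf 5) (by simp [fibBasis]) ?_⟩ <;> push_cast <;> ring

end WordComb

/-! ### Enumeration of the sums and their certificates. -/

/-- The indices of the inverse binomial Euler sums of weight at most `5`. -/
def ibesList : List (List ℕ × ℕ) :=
  [([], 2), ([], 3), ([1], 2), ([], 4), ([1], 3), ([2], 2), ([1, 1], 2), ([], 5), ([1], 4),
    ([2], 3), ([1, 1], 3), ([3], 2), ([2, 1], 2), ([1, 1, 1], 2)]

/-- Since `p ≥ 2` and every `a(k) ≥ 1`, at most three harmonic factors occur; each length leaves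
finitely many cases. Working with a list representing the multiset is harmless, since the final
comparisons are between multisets. -/
theorem ibesIndices_five :
    ibesIndices 5 = (ibesList.map fun x => ((x.1 : Multiset ℕ), x.2)).toFinset := by
  ext ⟨a, p⟩
  rw [Finset.mem_coe]
  constructor
  · induction a using Quotient.inductionOn with | _ l => ?_
    rintro ⟨h1, h2, h3⟩
    simp only [ibesWeight, Multiset.quot_mk_to_coe, Multiset.mem_coe, Multiset.sum_coe] at h1 h2 h3
    rw [Multiset.quot_mk_to_coe]
    match l with
    | [] =>
      simp only [List.sum_nil] at h3
      have hp : p ≤ 5 := by omega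
      interval_cases p <;> decide
    | [x] =>
      simp only [List.mem_cons, List.not_mem_nil, or_false, forall_eq, List.sum_cons,
        List.sum_nil] at h1 h3
      have hx : x ≤ 3 := by omega
      have hp : p ≤ 4 := by omega
      interval_cases x <;> interval_cases p <;> first | decide | omega
    | [x, y] =>
      simp only [List.mem_cons, List.not_mem_nil, or_false, forall_eq_or_imp, forall_eq,
        List.sum_cons, List.sum_nil] at h1 h3
      obtain ⟨hx, hy⟩ := h1
      have hx' : x ≤ 2 := by omega
      have hy' : y ≤ 2 := by omega
      have hp : p ≤ 3 := by omega
      interval_cases x <;> interval_cases y <;> interval_cases p <;> first | decide | omega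
    | [x, y, z] =>
      simp only [List.mem_cons, List.not_mem_nil, or_false, forall_eq_or_imp, forall_eq,
        List.sum_cons, List.sum_nil] at h1 h3
      obtain ⟨hx, hy, hz⟩ := h1
      obtain rfl : x = 1 := by omega
      obtain rfl : y = 1 := by omega
      obtain rfl : z = 1 := by omega
      obtain rfl : p = 2 := by omega
      decide
    | x :: y :: z :: w :: t =>
      simp only [List.mem_cons, forall_eq_or_imp, List.sum_cons] at h1 h3
      omega
  · intro h
    have hall : ∀ x ∈ (ibesList.map fun x => ((x.1 : Multiset ℕ), x.2)).toFinset,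
        (∀ k ∈ x.1, 1 ≤ k) ∧ 1 < x.2 ∧ x.1.sum + x.2 ≤ 5 := by decide
    exact hall _ h

open WordComb in
theorem proposition13 :
    (ibesIndices 5).ncard = 14 ∧
      ∀ (a : Multiset ℕ) (p : ℕ), (a, p) ∈ ibesIndices 5 →
        Summable (fun n : ℕ => ibesTerm a p (n + 1)) ∧
          IBES a p ∈ Submodule.span ℚ (fibBasis (ibesWeight a p)) := by
  refine ⟨by rw [ibesIndices_five, Set.ncard_coe_finset]; decide, fun a p h => ?_⟩
  rw [ibesIndices_five, Finset.mem_coe, List.mem_toFinset] at h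
  simp only [ibesList, List.map_cons, List.map_nil, List.mem_cons, List.not_mem_nil, or_false,
    Prod.mk.injEq] at h
  rcases h with ⟨rfl, rfl⟩ | ⟨rfl, rfl⟩ | ⟨rfl, rfl⟩ | ⟨rfl, rfl⟩ | ⟨rfl, rfl⟩ | ⟨rfl, rfl⟩ | ⟨rfl, rfl⟩ |
    ⟨rfl, rfl⟩ | ⟨rfl, rfl⟩ | ⟨rfl, rfl⟩ | ⟨rfl, rfl⟩ | ⟨rfl, rfl⟩ | ⟨rfl, rfl⟩ | ⟨rfl, rfl⟩
  -- The data say that `d` times the sum plus `cs` times the basis plus `es` times the relations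
  -- cancels formally, so the sum is `-cs/d` applied to the basis values; here it is `3 * π^2 / 6`.
  -- In the cases below, an `es` shorter than the list of relations leaves the last ones out.
  · exact summable_and_mem_span hasValue_basisTwo mem_span_fibBasis_two relationsTwo_isValid
      (a := []) (p := 2) (d := 1)
      (cs := [-3, 0])
      (es := [1])
      (by decide) (by decide) (by decide) (by decide +kernel)
  · exact summable_and_mem_span hasValue_basisThree mem_span_fibBasis_three relationsThree_isValid
      (a := []) (p := 3) (d := 2)
      (cs := [-12, 0, 7])
      (es := [4, 8, -8, 0, -1])
      (by decide) (by decide) (by decide) (by decide +kernel)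
  · exact summable_and_mem_span hasValue_basisThree mem_span_fibBasis_three relationsThree_isValid
      (a := [1]) (p := 2) (d := 2)
      (cs := [-12, 0, -7])
      (es := [4, 8, 0, -8, 1])
      (by decide) (by decide) (by decide) (by decide +kernel)
  · exact summable_and_mem_span hasValue_basisFour mem_span_fibBasis_four relationsFour_isValid
      (a := []) (p := 4) (d := 12)
      (cs := [57, -48, -4, 0, -96])
      (es := [-12, -9, 18, -48, 6, -6, 48, 0, -12, -96, 0, -72, -48, 0, 0, 0, 96, 0, -96])
      (by decide) (by decide) (by decide) (by decide +kernel)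
  · exact summable_and_mem_span hasValue_basisFour mem_span_fibBasis_four relationsFour_isValid
      (a := [1]) (p := 3) (d := 6)
      (cs := [-6, -48, 2, 0, 48])
      (es := [0, -9, -27, -72, -3, 9, -24, 0, 42, -48, -48, -36, -72, 48, -48, 0, 48, 48, -48, 24])
      (by decide) (by decide) (by decide) (by decide +kernel)
  · exact summable_and_mem_span hasValue_basisFour mem_span_fibBasis_four relationsFour_isValid
      (a := [2]) (p := 2) (d := 6)
      (cs := [6, -24, -2, 0, -48])
      (es := [-5, -8, 1, -24, -3, -11, 24, -8, -10, -64, -16, -28, -24, -16, -32, 8, 48, -32, -48])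
      (by decide) (by decide) (by decide) (by decide +kernel)
  · exact summable_and_mem_span hasValue_basisFour mem_span_fibBasis_four relationsFour_isValid
      (a := [1, 1]) (p := 2) (d := 2)
      (cs := [-81, -24, 2, 0, 48])
      (es := [5, -15, -45, -40, -5, -1, -24, -40, 18, 0, -16, 12, -40, -16, -64, 8, 16, 0, -16, 16])
      (by decide) (by decide) (by decide) (by decide +kernel)
  · exact summable_and_mem_span hasValue_basisFive mem_span_fibBasis_five relationsFive_isValid
      (a := []) (p := 5) (d := 120)
      (cs := [1140, -320, -16, -720, 0, -465, 0, 1920])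
      (es := [-43178, -4515, 52720, -20452, 24060, 0, -39680, 9920, 808, 2592, 2200, 2080, 6880, -27840,
        19200, -4320, 6080, -6880, 320, 1760, -960, 20160, 3040, -320, 6080, -320, -5440, 8480,
        -1280, 1600, 5120, 0, -2240, 5120, 1280, -520, 800, -24320, -4900, -1280, -5440, -960, 2880,
        -300, 8640, -960, -3440, -1760, -2240, 640, 38320, -1600, 3520, -2080, -14560, -960, 9280,
        640, 640, 320, 960, -640, 1920, -960, 4160, -3840, -1600, -960, 0, -960, -960])
      (by decide) (by decide) (by decide) (by decide +kernel)
  · exact summable_and_mem_span hasValue_basisFive mem_span_fibBasis_five relationsFive_isValid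
      (a := [1]) (p := 4) (d := 390)
      (cs := [-780, -2080, 52, -1170, 0, 6045, 0, -6240])
      (es := [-3923, -325, -3445, 5433, -2685, 0, 2560, -2960, -2412, -1308, -2050, -4440, -2235, -4300,
        -1760, 440, -4180, 2000, -7760, -3400, -9360, -4880, -14040, 1520, -2100, -880, -6160,
        -8080, -6400, -3120, -6240, 0, 9360, 1200, 7840, 630, -2680, -12200, 1580, -1600, -3120,
        3120, 1200, 780, -8340, -880, 7740, 2910, 3120, -160, -940, -3280, 4320, 4680, -6320, 3120,
        -2180, 0, 0, 2960, 7440, 0, 6240, -9360, 3120, 0, -3120, -9360, 1040, 3120, -3120])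
      (by decide) (by decide) (by decide) (by decide +kernel)
  · exact summable_and_mem_span hasValue_basisFive mem_span_fibBasis_five relationsFive_isValid
      (a := [2]) (p := 3) (d := 120)
      (cs := [240, -320, -16, -180, 0, -930, 0, 1920])
      (es := [-47099, -5005, 57740, -23706, 26500, 0, -43520, 10640, 984, 2856, 2680, 2720, 7730, -30400,
        20640, -4960, 6640, -8320, 800, 2080, -480, 21440, 4320, -800, 6880, -320, -5440, 9360,
        -320, 1920, 5760, 0, -2880, 5920, 1280, -680, 1760, -24800, -5520, -1280, -5760, -1440,
        2400, -240, 9760, -320, -4040, -2120, -2880, 640, 41600, -1760, 4000, -2400, -15200, -960,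
        10000, 480, 640, 160, 480, -960, 1920, -960, 3840, -3840, -1440, -480, 0, -1440, -960])
      (by decide) (by decide) (by decide) (by decide +kernel)
  · exact summable_and_mem_span hasValue_basisFive mem_span_fibBasis_five relationsFive_isValid
      (a := [1, 1]) (p := 3) (d := 60)
      (cs := [-4860, -480, 24, 630, 0, 3720, 0, -2880])
      (es := [3815, 95, -8280, 1850, -3870, 0, 4640, -3840, -1400, -1560, -240, -1280, -1640, 440, -3200,
        -400, -3320, -800, -1440, -2240, -2400, -6080, -5840, 1440, -1720, 480, -1280, -6080, -960,
        -1760, -4480, -1920, 4000, 800, 960, 80, 2080, 2480, 1240, -960, 1760, 3360, -1440, 660,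
        -4920, 800, 4120, 1120, 2080, 0, -6600, -800, 2560, 2480, 480, 1440, -3640, -320, -320, 160,
        1440, 320, 960, -2400, -1120, 1920, -160, -2400, 320, 1440, -480])
      (by decide) (by decide) (by decide) (by decide +kernel)
  · exact summable_and_mem_span hasValue_basisFive mem_span_fibBasis_five relationsFive_isValid
      (a := [3]) (p := 2) (d := 1560)
      (cs := [14820, -4160, -208, 7020, 0, -42315, 0, 24960])
      (es := [-578666, -59865, 698620, -290824, 319260, 0, -521600, 133280, 11056, 35664, 29800, 24160,
        92080, -363360, 258240, -67680, 82400, -100960, 9920, 20000, -12480, 270720, 39520, -9920,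
        82400, -6080, -71680, 113600, -14720, 20800, 66560, 0, -29120, 64640, 22400, -6520, 11360,
        -325760, -67060, -22400, -70720, -12480, 35520, -3900, 115680, -14400, -47120, -23480,
        -29120, 10240, 506320, -18880, 43840, -27040, -194560, -12480, 124960, 8320, 8320, 6080,
        10560, -8320, 24960, -12480, 54080, -49920, -20800, -12480, 0, -12480, -12480])
      (by decide) (by decide) (by decide) (by decide +kernel)
  · exact summable_and_mem_span hasValue_basisFive mem_span_fibBasis_five relationsFive_isValid
      (a := [2, 1]) (p := 2) (d := 1560)
      (cs := [-14820, -8320, 208, -14040, 0, 30225, 0, -24960])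
      (es := [67111, 6760, -97500, 47314, -48740, 0, 73600, -25040, -10936, -7224, -21400, -15200,
        -19130, 40240, -33440, 20320, -21440, 16160, -38240, -15200, -31200, -48000, -39520, 13280,
        -10000, -7360, -14080, -32880, -9280, -8320, -16640, 0, 29120, -13600, 17920, 4040, -21280,
        640, 13380, 7040, -16640, 6240, -5280, 3900, -30800, 960, 30840, 13560, 4160, 3200, -63360,
        -11360, -5280, 14560, -480, 12480, -21920, -2080, 0, 13600, 19680, -4160, 24960, -37440,
        8320, 0, -10400, -31200, 4160, 6240, -12480])
      (by decide) (by decide) (by decide) (by decide +kernel)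
  · exact summable_and_mem_span hasValue_basisFive mem_span_fibBasis_five relationsFive_isValid
      (a := [1, 1, 1]) (p := 2) (d := 1560)
      (cs := [-354900, -16640, 1040, -28080, 0, 30225, 0, -124800])
      (es := [811636, 73125, -1047800, 226904, -477060, -149760, 731200, -222880, -91376, -39504,
        -224960, 26560, -158420, 552000, -154560, 91680, -114880, 8480, -32320, -64960, 62400,
        -329280, -247520, 107200, -15040, 24640, 6080, -252160, 4480, -79040, -208000, 0, 170560,
        -129280, -19840, 22400, -85120, 302080, 120860, -55040, 104000, 62400, -108480, 38220,
        -156480, 41280, 159760, 56320, 95680, 29440, -766160, -24640, -50240, 110240, 114560, 62400,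
        -224960, -16640, -16640, 320, 16320, 16640, 24960, -87360, -70720, 99840, 4160, -87360,
        12480, 62400, -12480])
      (by decide) (by decide) (by decide) (by decide +kernel)
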